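/- Let $\nu\ge 2$ and $k_1,\dots,k_\nu>1$ be integers, and let $\beta_{ij}$ ($1\le i\le\nu$, $1\le j\le k_i$) be positive integers with $\sum_j\beta_{ij}=N$ for every $i$. Let $P=P(\beta)$ be the polytope of real $k_1\times\dots\times k_\nu$ arrays $x=(\xi_{j_1\dots j_\nu})$ with $x\ge 0$ that satisfy the system $Ax=b$ of the $d=k_1+\dots+k_\nu-\nu+1$ equations $$\sum_{j_1,\dots,j_\nu:\ j_i=j}\xi_{j_1\dots j_\nu}=\beta_{ij}\quad(1\le i\le\nu,\ 1\le j\le k_i-1),\qquad \sum_{j_1,\dots,j_\nu}\xi_{j_1\dots j_\nu}=N ,$$ and let $P^{01}=P\cap\{x:\ \xi_{j_1\dots j_\nu}\le 1\text{ for all }j_1,\dots,j_\nu\}$. Integer points of $P$ are the $\nu$-way contingency tables with sectional sums $\beta_{ij}$; 0-1 points of $P$ are the binary ones. Let $a_p$ denote the columns of $A$, $p=(j_1,\dots,j_\nu)$, let $\Lambda=A(\mathbb Z^{k_1\cdots k_\nu})\subset\mathbb Z^d$, and put $$g(x)=\sum_p\bigl((\xi_p+1)\ln(\xi_p+1)-\xi_p\ln\xi_p\bigr),\qquad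 h(x)=\sum_p\Bigl(\xi_p\ln\tfrac1{\xi_p}+(1-\xi_p)\ln\tfrac1{1-\xi_p}\Bigr).$$ For $z=(\zeta_p)$ put $$G(z)=\frac{e^{g(z)}\det\Lambda}{(2\pi)^{d/2}(\det BB^T)^{1/2}},\qquad H(z)=\frac{e^{h(z)}\det\Lambda}{(2\pi)^{d/2}(\det B_{01}B_{01}^T)^{1/2}},$$ where $B$ has columns $(\zeta_p^2+\zeta_p)^{1/2}a_p$ and $B_{01}$ has columns $(\zeta_p-\zeta_p^2)^{1/2}a_p$. Then the following hold. (0) If $\nu\geq 2$ and $k_1=\dots=k_\nu=k>1$, then $\det AA^T=k^{(\nu^2-\nu)(k-1)}$. Now let $\nu\ge5$ be fixed. (1) For all real $c,\delta,\epsilon>0$ and all real $C,M$ there is $n_0$ such that for all $n\ge n_0$, all $k_1,\dots,k_\nu>1$ with $cn\le k_i\le Cn$, and all $\beta$ as above: if $z$ maximizes $g$ on $P$ and $\delta\le\zeta_p\le M$ for all $p$, then $\bigl|\,|P\cap\mathbb Z^{k_1\cdots k_\nu}|/G(z)-1\bigr|\le\epsilon$. (2) For all real $c,\epsilon>0$,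 $0<\delta<1/2$ and all real $C$ there is $n_0$ such that for all $n\ge n_0$, all $k_1,\dots,k_\nu>1$ with $cn\le k_i\le Cn$, and all $\beta$ as above: if $z$ maximizes $h$ on $P^{01}$ and $\delta\le\zeta_p\le1-\delta$ for all $p$, then $\bigl|\,|P\cap\{0,1\}^{k_1\cdots k_\nu}|/H(z)-1\bigr|\le\epsilon$. (3) Let $0<a\le b$. As $k\to\infty$, uniformly over all $\alpha\in[a,b]$ such that $r=\alpha k^{\nu-1}$ is an integer, the number of nonnegative integer $\nu$-way $k\times\dots\times k$ tables with all sectional sums equal to $r$ is $$(1+o(1))\bigl((\alpha+1)^{\alpha+1}\alpha^{-\alpha}\bigr)^{k^\nu}(2\pi\alpha^2+2\pi\alpha)^{-(k\nu-\nu+1)/2}\,k^{(\nu-\nu^2)(k-1)/2}.$$ (4) Let $0<a\le b<1$. As $k\to\infty$, uniformly over all $\alpha\in[a,b]$ such that $r=\alpha k^{\nu-1}$ is an integer, the number of binary $\nu$-way $k\times\dots\times k$ tables with all sectional sums equal to $r$ is $$(1+o(1))\bigl(\alpha^{\alpha}(1-\alpha)^{1-\alpha}\bigr)^{-k^\nu}(2\pi\alpha-2\pi\alpha^2)^{-(k\nu-\nu+1)/2}\,k^{(\nu-\nu^2)(k-1)/2}.$$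 -/

import Mathlib

open Matrix

noncomputable section

/-! Polytopes `A x = b`, `x ≥ 0` (or `0 ≤ x ≤ 1`) with integer data, and the Gaussian formulas.
`D` indexes the equations and `J` the coordinates. -/

section General

variable {D J : Type} [Fintype D] [DecidableEq D] [Fintype J]

/-- The polytope of all real `x` with `A x = b` and `x ≥ 0`. -/
def polytope (A : Matrix D J ℤ) (b : D → ℤ) : Set (J → ℝ) :=
  {x | (A.map (Int.cast : ℤ → ℝ)) *ᵥ x = (fun i => (b i : ℝ)) ∧ ∀ j, 0 ≤ x j}

/-- The polytope of all real `x` with `A x = b` and `0 ≤ x ≤ 1`. -/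
def polytope01 (A : Matrix D J ℤ) (b : D → ℤ) : Set (J → ℝ) :=
  {x | x ∈ polytope A b ∧ ∀ j, x j ≤ 1}

/-- The number of integer points in a set. -/
def numIntegerPoints (P : Set (J → ℝ)) : ℕ :=
  {x | x ∈ P ∧ ∀ j, ∃ m : ℤ, x j = (m : ℝ)}.ncard

/-- The number of points in a set all of whose coordinates are `0` or `1`. -/
def numBinaryPoints (P : Set (J → ℝ)) : ℕ :=
  {x | x ∈ P ∧ ∀ j, x j = 0 ∨ x j = 1}.ncard

/-- The entropy `g` of a vector of independent geometric random variables with expectations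
`x j`. -/
def geomEntropy (x : J → ℝ) : ℝ :=
  ∑ j, ((x j + 1) * Real.log (x j + 1) - x j * Real.log (x j))

/-- The entropy `h` of a vector of independent Bernoulli random variables with expectations
`x j`. -/
def bernoulliEntropy (x : J → ℝ) : ℝ :=
  ∑ j, (x j * Real.log (1 / x j) + (1 - x j) * Real.log (1 / (1 - x j)))

/-- The matrix whose `j`-th column is `√(w j)` times the `j`-th column of `A`. -/
def weightedMatrix (A : Matrix D J ℤ) (w : J → ℝ) : Matrix D J ℝ :=
  Matrix.of fun i j => Real.sqrt (w j) * (A i j : ℝ)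

/-- The image `Λ = A(ℤ^J)` of the integer lattice, as a lattice in `ℝ^D`. -/
def imageLattice (A : Matrix D J ℤ) : Submodule ℤ (D → ℝ) :=
  Submodule.span ℤ (Set.range fun (y : J → ℤ) (i : D) => ((A *ᵥ y) i : ℝ))

/-- `e^S det Λ / ((2π)^{d/2} (det B Bᵀ)^{1/2})`, where `B` has columns `√(w j) a_j`. -/
def gaussianFormula (A : Matrix D J ℤ) (S : ℝ) (w : J → ℝ) : ℝ :=
  Real.exp S * ZLattice.covolume (imageLattice A) /
    ((2 * Real.pi) ^ ((Fintype.card D : ℝ) / 2) *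
      Real.sqrt (weightedMatrix A w * (weightedMatrix A w)ᵀ).det)

/-- The Gaussian formula for the number of integer points. -/
def gaussianInteger (A : Matrix D J ℤ) (z : J → ℝ) : ℝ :=
  gaussianFormula A (geomEntropy z) (fun j => z j ^ 2 + z j)

/-- The Gaussian formula for the number of 0-1 points. -/
def gaussianBinary (A : Matrix D J ℤ) (z : J → ℝ) : ℝ :=
  gaussianFormula A (bernoulliEntropy z) (fun j => z j - z j ^ 2)

end General

/-! Multi-way tables of format `k 0 × … × k (ν - 1)`. -/

/-- Index set of the entries of the table. -/
abbrev Cell {ν : ℕ} (k : Fin ν → ℕ) : Type := (i : Fin ν) → Fin (k i)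

/-- Index set of the equations: `some ⟨i, j⟩` is the `j`-th sectional sum in direction `i`, with
the last section of each direction left out, and `none` is the total sum. -/
abbrev Constraint {ν : ℕ} (k : Fin ν → ℕ) : Type := Option ((i : Fin ν) × Fin (k i - 1))

/-- The matrix of the equations that prescribe all but the last sectional sums in each direction,
and the total sum. -/
def tableMatrix {ν : ℕ} (k : Fin ν → ℕ) : Matrix (Constraint k) (Cell k) ℤ :=
  Matrix.of fun c p =>
    match c with
    | none => 1
    | some ⟨i, j⟩ => if (p i : ℕ) = (j : ℕ) then 1 else 0

/-- The right-hand side of the equations: sectional sums `β i j` and total sum `N`. -/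
def tableRhs {ν : ℕ} (k : Fin ν → ℕ) (β : (i : Fin ν) → Fin (k i) → ℕ) (N : ℕ) :
    Constraint k → ℤ
  | none => N
  | some ⟨i, j⟩ => β i (Fin.castLE (Nat.sub_le _ _) j)

/-- The transportation polytope with sectional sums `β` and total sum `N`. -/
def transportPolytope {ν : ℕ} (k : Fin ν → ℕ) (β : (i : Fin ν) → Fin (k i) → ℕ) (N : ℕ) :
    Set (Cell k → ℝ) :=
  polytope (tableMatrix k) (tableRhs k β N)

/-- The transportation polytope truncated by the inequalities `x ≤ 1`. -/
def transportPolytope01 {ν : ℕ} (k : Fin ν → ℕ) (β : (i : Fin ν) → Fin (k i) → ℕ) (N : ℕ) :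
    Set (Cell k → ℝ) :=
  polytope01 (tableMatrix k) (tableRhs k β N)

end

/-! The proof uses maximum entropy and a local limit theorem. Give the cells independent geometric
(or Bernoulli) variables `X_p` with expectations `ζ_p`. The logarithm of the probability of a table
is affine in the table. Since `z` is a critical point of the entropy on the polytope, the linear
part vanishes along `x - z`, so every table in the polytope has the same probability `e^{-g(z)}` (or
`e^{-h(z)}`). Hence the number of tables is `e^{g(z)} Pr(AX = b)` (`measureReal_pi_eq_ncard_mul`).
Moreover `b` is the expectation of `AX`, and the columns of `A` generate `ℤ^d`, so `det Λ = 1`.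

By Fourier inversion, `(2π)^d Pr(AX = b)` is the integral over a cube of the product of the
characteristic functions at the linear forms `θ_p(t) = ⟨a_p, t⟩` (`measureReal_linear_system`). On
the region `∑ θ_p² ≤ s` the integrand is close to `exp(-½ ∑ w_p θ_p²)`, with `w_p` the variance of
`X_p`; its relative error is governed by `∑ |θ_p|³ ≤ s max |θ_p|`. Outside that region both
integrands are exponentially small in `s`.

What makes this work is `subadditive_coord_le`: a coordinate of `t` is a difference of two linear
forms in very many ways, so a bound on the mean square of the `θ_p` bounds every coordinate, and
with it every `θ_p`, by `O(√(s m))`, where `m` bounds `k_i / (k_1 ⋯ k_ν)`. Applied to `|e^{ix} - 1|`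
instead of `|x|`, the same lemma treats the linear forms modulo `2π`. For sides of order `n` the
choice `s = n^{5/4}` beats the factor `e^{O(n log n)}` coming from volumes and determinants, while
`s √(s m)` tends to `0` as soon as `ν ≥ 5`.

For equal sides and equal sums the constant table is a critical point, because the total sum is
prescribed. Its Gaussian formula is explicit once `det A Aᵀ` is computed by a Schur complement. -/

open MeasureTheory

/-! ### Gaussian integrals -/

section Gaussian

variable {D : Type} [Fintype D]

lemma integral_exp_neg_mul_dotProduct_self {a : ℝ} (ha : 0 < a) :
    Integrable (fun y : D → ℝ => Real.exp (-a * (y ⬝ᵥ y))) ∧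
      ∫ y : D → ℝ, Real.exp (-a * (y ⬝ᵥ y)) = Real.sqrt (Real.pi / a) ^ Fintype.card D := by
  have h : (fun y : D → ℝ => Real.exp (-a * (y ⬝ᵥ y))) =
      fun y => ∏ i, Real.exp (-a * y i ^ 2) := by
    funext y
    rw [← Real.exp_sum, dotProduct, Finset.mul_sum]
    congr 1
    exact Finset.sum_congr rfl fun i _ => by ring
  constructor
  · rw [h, volume_pi]
    exact Integrable.fintype_prod (f := fun _ x => Real.exp (-a * x ^ 2))
      fun _ => integrable_exp_neg_mul_sq ha
  · rw [h, integral_fintype_prod_volume_eq_pow (fun x : ℝ => Real.exp (-a * x ^ 2)),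
      integral_gaussian]

variable [DecidableEq D]

lemma Matrix.PosDef.exists_transpose_mul_self {Q : Matrix D D ℝ} (hQ : Q.PosDef) :
    ∃ Y : Matrix D D ℝ, Q = Yᵀ * Y := by
  open scoped MatrixOrder Matrix.Norms.L2Operator in
  obtain ⟨Y, hY⟩ := CStarAlgebra.nonneg_iff_eq_star_mul_self.mp hQ.posSemidef.nonneg
  exact ⟨Y, by rw [hY, star_eq_conjTranspose, conjTranspose_eq_transpose_of_trivial]⟩

/-- The Gaussian integral of a positive definite quadratic form. -/
lemma Matrix.PosDef.integral_exp_neg_mul {Q : Matrix D D ℝ} (hQ : Q.PosDef) {a : ℝ}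
    (ha : 0 < a) :
    Integrable (fun t : D → ℝ => Real.exp (-a * (t ⬝ᵥ Q *ᵥ t))) ∧
      ∫ t : D → ℝ, Real.exp (-a * (t ⬝ᵥ Q *ᵥ t)) =
        Real.sqrt (Real.pi / a) ^ Fintype.card D / Real.sqrt Q.det := by
  -- The substitution `y = Y t` turns the form into `y ⬝ᵥ y`; its Jacobian is `|det Y| = √(det Q)`.
  obtain ⟨Y, hY⟩ := hQ.exists_transpose_mul_self
  have hdet : Q.det = Y.det ^ 2 := by rw [hY, det_mul, det_transpose, sq]
  have hY0 : Y.det ≠ 0 := by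
    intro h
    have := hQ.det_pos
    rw [hdet, h] at this
    simp at this
  have hq : ∀ t : D → ℝ, t ⬝ᵥ Q *ᵥ t = toLin' Y t ⬝ᵥ toLin' Y t := by
    intro t
    rw [hY, toLin'_apply, ← mulVec_mulVec, dotProduct_mulVec, vecMul_transpose]
  have hmap := Real.map_matrix_volume_pi_eq_smul_volume_pi hY0
  have hmeas : Measurable (toLin' Y) := (LinearMap.continuous_on_pi _).measurable
  obtain ⟨hI, hv⟩ := integral_exp_neg_mul_dotProduct_self (D := D) ha
  have hI' : Integrable (fun y : D → ℝ => Real.exp (-a * (y ⬝ᵥ y)))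
      (Measure.map (toLin' Y) volume) := by
    rw [hmap]
    exact hI.smul_measure ENNReal.ofReal_ne_top
  constructor
  · simp_rw [hq]
    exact hI'.comp_measurable hmeas
  · simp_rw [hq]
    rw [← integral_map hmeas.aemeasurable hI'.aestronglyMeasurable
      (f := fun y : D → ℝ => Real.exp (-a * (y ⬝ᵥ y))), hmap, integral_smul_measure, hv, hdet,
      Real.sqrt_sq_eq_abs, ENNReal.toReal_ofReal (abs_nonneg _), abs_inv, smul_eq_mul]
    ring

end Gaussian

/-! ### Fourier inversion on the torus -/

section Fourier

lemma integral_exp_int_mul (m : ℤ) :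
    ∫ x in Set.Ioc (-Real.pi) Real.pi, Complex.exp (Complex.I * (x * m)) =
      if m = 0 then (2 * Real.pi : ℂ) else 0 := by
  rw [← intervalIntegral.integral_of_le (by linarith [Real.pi_pos])]
  split_ifs with h
  · subst h
    simp
    ring
  · have hc : (Complex.I * m : ℂ) ≠ 0 := by simp [h]
    have := integral_exp_mul_complex (a := -Real.pi) (b := Real.pi) hc
    have e : ∀ x : ℝ, Complex.I * (x * m) = Complex.I * m * x := fun x => by ring
    simp_rw [e]
    rw [this]
    have : Complex.exp (Complex.I * m * Real.pi) =
        Complex.exp (Complex.I * m * (-Real.pi : ℝ)) := by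
      rw [Complex.exp_eq_exp_iff_exists_int]
      exact ⟨m, by push_cast; ring⟩
    rw [this]
    simp

variable {D : Type} [Fintype D]

/-- The cube `(-π, π]^D`. -/
def torusCube (D : Type) : Set (D → ℝ) := Set.univ.pi fun _ => Set.Ioc (-Real.pi) Real.pi

lemma volume_torusCube : volume (torusCube D) = ENNReal.ofReal (2 * Real.pi) ^ Fintype.card D := by
  rw [torusCube, volume_pi_pi]
  simp only [Real.volume_Ioc, Finset.prod_const, Finset.card_univ, sub_neg_eq_add, ← two_mul]

instance isFiniteMeasure_restrict_torusCube :
    IsFiniteMeasure ((volume : Measure (D → ℝ)).restrict (torusCube D)) :=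
  ⟨by
    rw [Measure.restrict_apply_univ, volume_torusCube]
    exact ENNReal.pow_lt_top ENNReal.ofReal_lt_top⟩

lemma setIntegral_torusCube_exp (m : D → ℤ) :
    ∫ t in torusCube D, Complex.exp (Complex.I * (∑ c, t c * m c : ℝ)) =
      if m = 0 then (2 * Real.pi : ℂ) ^ Fintype.card D else 0 := by
  have h : (fun t : D → ℝ => Complex.exp (Complex.I * (∑ c, t c * m c : ℝ))) =
      fun t => ∏ c, Complex.exp (Complex.I * (t c * m c)) := by
    funext t
    rw [← Complex.exp_sum, ← Finset.mul_sum]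
    push_cast
    rfl
  rw [h, torusCube, volume_pi, Measure.restrict_pi_pi,
    integral_fintype_prod_eq_prod (𝕜 := ℂ)
      (fun c (x : ℝ) => Complex.exp (Complex.I * (x * m c)))]
  simp_rw [integral_exp_int_mul]
  split_ifs with hm
  · subst hm
    simp
  · obtain ⟨c, hc⟩ := Function.ne_iff.mp hm
    exact Finset.prod_eq_zero (Finset.mem_univ c) (if_neg hc)

variable {J : Type}

/-- The value at `t` of the linear form given by the `j`-th column of `A`. -/
def linForm (A : Matrix D J ℤ) (t : D → ℝ) (j : J) : ℝ := ∑ c, (A c j : ℝ) * t c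

/-- The probability that independent integer random variables satisfy a system of linear equations
is an integral of the product of their characteristic functions. -/
lemma measureReal_linear_system [Fintype J] (A : Matrix D J ℤ) (b : D → ℤ) (μ : J → Measure ℕ)
    [∀ j, IsProbabilityMeasure (μ j)] :
    (((Measure.pi μ).real {x : J → ℕ | (A *ᵥ fun j => (x j : ℤ)) = b} : ℝ) : ℂ) *
        (2 * Real.pi : ℂ) ^ Fintype.card D =
      ∫ t in torusCube D, (∏ j, ∫ x, Complex.exp (Complex.I * ((linForm A t j : ℝ) * x)) ∂μ j) *
        Complex.exp (-(Complex.I * (∑ c, t c * b c : ℝ))) := by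
  classical
  set S := {x : J → ℕ | (A *ᵥ fun j => (x j : ℤ)) = b} with hS
  have hSm : MeasurableSet S := S.to_countable.measurableSet
  let f : (D → ℝ) → (J → ℕ) → ℂ := fun t x =>
    Complex.exp (Complex.I * (∑ c, t c * ((A *ᵥ fun j => (x j : ℤ)) c - b c : ℤ) : ℝ))
  have h1 : ∀ t, (∏ j, ∫ x, Complex.exp (Complex.I * ((linForm A t j : ℝ) * x)) ∂μ j) *
        Complex.exp (-(Complex.I * (∑ c, t c * b c : ℝ))) = ∫ x, f t x ∂Measure.pi μ := by
    intro t
    rw [← integral_fintype_prod_eq_prod (𝕜 := ℂ)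
      (fun j (x : ℕ) => Complex.exp (Complex.I * ((linForm A t j : ℝ) * x))),
      ← integral_mul_const]
    congr 1
    funext x
    simp only [f]
    rw [← Complex.exp_sum, ← Complex.exp_add]
    congr 1
    rw [← Finset.mul_sum, ← sub_eq_add_neg, ← mul_sub]
    congr 1
    push_cast [linForm, mulVec, dotProduct]
    simp_rw [mul_sub, Finset.sum_sub_distrib, Finset.sum_mul, Finset.mul_sum]
    rw [Finset.sum_comm]
    congr 1
    exact Finset.sum_congr rfl fun c _ => Finset.sum_congr rfl fun j _ => by ring
  -- Orthogonality of characters: integrating over the cube before taking the expectation leaves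
  -- `(2π)^d` times the indicator of the event.
  have h2 : ∀ x, ∫ t in torusCube D, f t x =
      S.indicator (fun _ => (2 * Real.pi : ℂ) ^ Fintype.card D) x := by
    intro x
    simp only [f]
    rw [setIntegral_torusCube_exp]
    by_cases hx : x ∈ S
    · rw [if_pos, Set.indicator_of_mem hx]
      funext c
      have : (A *ᵥ fun j => (x j : ℤ)) = b := hx
      simp [this]
    · rw [if_neg, Set.indicator_of_notMem hx]
      intro h
      exact hx (funext fun c => sub_eq_zero.mp (congrFun h c))
  simp_rw [h1]
  rw [integral_integral_swap]
  · simp_rw [h2]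
    rw [integral_indicator_const _ hSm, Complex.real_smul]
  · refine Integrable.of_bound (C := 1) ?_ ?_
    · refine Measurable.aestronglyMeasurable ?_
      refine measurable_from_prod_countable_left fun x => ?_
      simp only [f, Function.uncurry]
      fun_prop
    · refine Filter.Eventually.of_forall fun tx => ?_
      simp only [f, Function.uncurry]
      rw [mul_comm, Complex.norm_exp_ofReal_mul_I]

end Fourier

/-! ### Characteristic functions of geometric and Bernoulli random variables -/

section CharFun

/-- The Taylor polynomials of degree two of the two factors are inverse to each other up to cubic
terms. Negative `x` is allowed so that one estimate serves twice: the geometric characteristic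
function is the inverse of the first factor, and the Bernoulli one is the first factor at `-x`. -/
lemma exists_norm_pgf_mul_exp_sub_one_le (M : ℝ) :
    ∃ L : ℝ, 0 ≤ L ∧ ∀ x θ : ℝ, |x| ≤ M → |θ| ≤ 1 →
      ‖(1 + x - x * Complex.exp (Complex.I * θ)) *
        Complex.exp (Complex.I * (x * θ) - (x + x ^ 2) * θ ^ 2 / 2) - 1‖ ≤ L * |θ| ^ 3 := by
  -- The cofactor in `(1 - ixθ + xθ²/2)(1 + u + u²/2) - 1 = θ³ R(x, θ)`, where `u` is the exponent:
  -- all terms of order below three cancel.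
  let R : ℝ × ℝ → ℂ := fun v =>
    (-(Complex.I * v.1 * (v.1 + v.1 ^ 2)) / 2 + Complex.I * v.1 * ((v.1 + 2 * v.1 ^ 2) / 2)
      + Complex.I * v.1 ^ 2 / 2)
    + ((v.1 + v.1 ^ 2) ^ 2 / 8 - v.1 ^ 2 * (v.1 + v.1 ^ 2) / 2
      - v.1 * (v.1 + 2 * v.1 ^ 2) / 4) * v.2
    + (-(Complex.I * v.1 * (v.1 + v.1 ^ 2) ^ 2 / 8)
      - Complex.I * v.1 ^ 2 * (v.1 + v.1 ^ 2) / 4) * v.2 ^ 2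
    + v.1 * (v.1 + v.1 ^ 2) ^ 2 / 16 * v.2 ^ 3
  have hR : Continuous R := by fun_prop
  obtain ⟨C, hC⟩ := ((isCompact_Icc (a := -M) (b := M)).prod
    (isCompact_Icc (a := (-1 : ℝ)) (b := 1))).exists_bound_of_continuousOn hR.continuousOn
  let B : ℝ := M + (M + M ^ 2)
  -- The three summands bound the polynomial part, the Taylor remainder of `exp u` and that of `exp
  -- (iθ)`. The absolute values keep the constant nonnegative for every real `M`.
  refine ⟨|C| + (1 + 2 * |M|) * (|B| ^ 3 * Real.exp |B|) + |M| * Real.exp 1 * Real.exp |B|,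
    by positivity, fun x θ hx hθ => ?_⟩
  have hM : 0 ≤ M := (abs_nonneg x).trans hx
  have hB : 0 ≤ B := by positivity
  rw [abs_of_nonneg hM, abs_of_nonneg hB]
  have hCC : ‖R (x, θ)‖ ≤ |C| :=
    (hC (x, θ) ⟨abs_le.mp hx, abs_le.mp hθ⟩).trans (le_abs_self _)
  have hx2 : x ^ 2 ≤ M ^ 2 := sq_le_sq' (by linarith [abs_le.mp hx]) (by linarith [abs_le.mp hx])
  have hθ2 : θ ^ 2 ≤ |θ| := by
    rw [← sq_abs]; nlinarith [abs_nonneg θ]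
  have hθ0 := abs_nonneg θ
  set u : ℂ := Complex.I * (x * θ) - (x + x ^ 2) * θ ^ 2 / 2 with hu
  have hun : ‖u‖ ≤ B * |θ| := by
    have e1 : ‖Complex.I * ((x : ℂ) * θ)‖ = |x| * |θ| := by simp
    have e2 : ‖((x : ℂ) + x ^ 2) * θ ^ 2 / 2‖ = |x + x ^ 2| * θ ^ 2 / 2 := by
      rw [show ((x : ℂ) + x ^ 2) * θ ^ 2 / 2 = (((x + x ^ 2) * θ ^ 2 / 2 : ℝ) : ℂ) by
        push_cast; ring, Complex.norm_real, Real.norm_eq_abs, abs_div, abs_mul]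
      simp
    have e3 : |x + x ^ 2| ≤ M + M ^ 2 :=
      (abs_add_le _ _).trans (by rw [abs_of_nonneg (sq_nonneg x)]; linarith)
    calc ‖u‖ ≤ _ := norm_sub_le _ _
      _ = |x| * |θ| + |x + x ^ 2| * θ ^ 2 / 2 := by rw [e1, e2]
      _ ≤ M * |θ| + (M + M ^ 2) * |θ| := by
        have := mul_le_mul e3 hθ2 (sq_nonneg θ) (by positivity)
        have := mul_le_mul_of_nonneg_right hx hθ0
        have : 0 ≤ |x + x ^ 2| * θ ^ 2 := by positivity
        linarith
      _ = _ := by ring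
  have hunB : ‖u‖ ≤ B := hun.trans (by nlinarith)
  obtain ⟨r, hr, hrn⟩ : ∃ r : ℂ, Complex.exp (Complex.I * θ) =
      1 + Complex.I * θ + (Complex.I * θ) ^ 2 / 2 + r ∧ ‖r‖ ≤ |θ| ^ 3 * Real.exp 1 := by
    refine ⟨_, (add_sub_cancel _ _).symm, ?_⟩
    have := Complex.norm_exp_sub_sum_le_norm_mul_exp (Complex.I * θ) 3
    simp only [Finset.sum_range_succ, Finset.sum_range_zero, Nat.factorial] at this
    norm_num at this
    refine this.trans ?_
    gcongr
  obtain ⟨ρ, hρ, hρn⟩ : ∃ ρ : ℂ, Complex.exp u = 1 + u + u ^ 2 / 2 + ρ ∧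
      ‖ρ‖ ≤ |θ| ^ 3 * (B ^ 3 * Real.exp B) := by
    refine ⟨_, (add_sub_cancel _ _).symm, ?_⟩
    have := Complex.norm_exp_sub_sum_le_norm_mul_exp u 3
    simp only [Finset.sum_range_succ, Finset.sum_range_zero, Nat.factorial] at this
    norm_num at this
    refine this.trans ?_
    calc ‖u‖ ^ 3 * Real.exp ‖u‖ ≤ (B * |θ|) ^ 3 * Real.exp B := by gcongr
      _ = _ := by ring
  have hexp : ‖Complex.exp u‖ ≤ Real.exp B :=
    (Complex.norm_exp_le_exp_norm u).trans (Real.exp_le_exp.mpr hunB)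
  set Q : ℂ := 1 - Complex.I * x * θ + x * θ ^ 2 / 2 with hQ
  have hQn : ‖Q‖ ≤ 1 + 2 * M := by
    calc ‖Q‖ ≤ ‖(1 : ℂ)‖ + ‖Complex.I * x * θ‖ + ‖(x : ℂ) * θ ^ 2 / 2‖ :=
          (norm_add_le _ _).trans (by gcongr; exact norm_sub_le _ _)
      _ = 1 + |x| * |θ| + |x| * |θ| ^ 2 / 2 := by simp
      _ ≤ 1 + M * 1 + M * 1 ^ 2 / 2 := by gcongr
      _ ≤ _ := by linarith
  have key : (1 + x - x * Complex.exp (Complex.I * θ)) * Complex.exp u - 1 =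
      θ ^ 3 * R (x, θ) + Q * ρ - x * r * Complex.exp u := by
    have h1 : (1 + x - x * Complex.exp (Complex.I * θ)) * Complex.exp u - 1 =
        (Q * (1 + u + u ^ 2 / 2) - 1) + Q * ρ - x * r * Complex.exp u := by
      have : (1 + x - x * Complex.exp (Complex.I * θ)) = Q - x * r := by
        rw [hr, hQ]; ring_nf; rw [Complex.I_sq]; ring
      rw [this, sub_mul, hρ]; ring
    rw [h1]
    congr 2
    simp only [hQ, hu, R]
    ring_nf
    simp only [Complex.I_sq, show Complex.I ^ 3 = -Complex.I by
      rw [pow_succ, Complex.I_sq]; ring]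
    ring
  rw [key]
  calc _ ≤ ‖(θ : ℂ) ^ 3 * R (x, θ)‖ + ‖Q * ρ‖ + ‖(x : ℂ) * r * Complex.exp u‖ :=
        (norm_sub_le _ _).trans (by gcongr; exact norm_add_le _ _)
    _ = |θ| ^ 3 * ‖R (x, θ)‖ + ‖Q‖ * ‖ρ‖ + |x| * ‖r‖ * ‖Complex.exp u‖ := by simp
    _ ≤ |θ| ^ 3 * |C| + (1 + 2 * M) * (|θ| ^ 3 * (B ^ 3 * Real.exp B))
        + M * (|θ| ^ 3 * Real.exp 1) * Real.exp B := by gcongr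
    _ = _ := by ring

/-- The source of the decay in `1 - cos θ`: the coefficient `x + x²` is the geometric variance at
`x`, and minus the Bernoulli variance when `x` is replaced by its negative. -/
lemma normSq_pgf (x θ : ℝ) : ‖1 + x - x * Complex.exp (Complex.I * θ)‖ ^ 2 =
    1 + 2 * (x + x ^ 2) * (1 - Real.cos θ) := by
  have h : (1 + x - x * Complex.exp (Complex.I * θ) : ℂ) =
      ⟨1 + x - x * Real.cos θ, -(x * Real.sin θ)⟩ := by
    rw [mul_comm Complex.I, Complex.exp_mul_I]
    apply Complex.ext <;> simp [Complex.cos_ofReal_re, Complex.sin_ofReal_re]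
  rw [h, ← Complex.normSq_eq_norm_sq, Complex.normSq_mk]
  have := Real.sin_sq_add_cos_sq θ
  linear_combination x ^ 2 * this

/-- The characteristic function of a measure on `ℕ`. -/
noncomputable def natCharFun (μ : Measure ℕ) (θ : ℝ) : ℂ := ∫ x : ℕ, Complex.exp (Complex.I * (θ * x)) ∂μ

open ProbabilityTheory

/-- The geometric distribution with expectation `x ≥ 0`. -/
noncomputable def geomDist (x : ℝ) : Measure ℕ :=
  geometricMeasure (Set.projIcc 0 1 zero_le_one (1 / (1 + x)))

instance (x : ℝ) : IsProbabilityMeasure (geomDist x) := by unfold geomDist; infer_instance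

/-- The Bernoulli distribution with expectation `x ∈ [0, 1]`. -/
noncomputable def bernDist (x : ℝ) : Measure ℕ := bernoulliMeasure 1 0 (Set.projIcc 0 1 zero_le_one x)

instance (x : ℝ) : IsProbabilityMeasure (bernDist x) := by unfold bernDist; infer_instance

lemma projIcc_coe_of_mem {y : ℝ} (h0 : 0 ≤ y) (h1 : y ≤ 1) :
    ((Set.projIcc (0 : ℝ) 1 zero_le_one y : unitInterval) : ℝ) = y := by
  rw [Set.projIcc_of_mem zero_le_one (Set.mem_Icc.mpr ⟨h0, h1⟩)]

lemma projIcc_inv_coe {x : ℝ} (hx : 0 < x) :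
    ((Set.projIcc (0 : ℝ) 1 zero_le_one (1 / (1 + x)) : unitInterval) : ℝ) = 1 / (1 + x) :=
  projIcc_coe_of_mem (by positivity) (by rw [div_le_one (by positivity)]; linarith)

lemma projIcc_inv_ne_zero {x : ℝ} (hx : 0 < x) :
    (Set.projIcc (0 : ℝ) 1 zero_le_one (1 / (1 + x)) : unitInterval) ≠ 0 := by
  intro h
  have h2 := projIcc_inv_coe hx
  rw [h] at h2
  have : 0 < 1 / (1 + x) := by positivity
  exact this.ne h2

/-- The logarithm of `x^n / (1 + x)^(n + 1)` is affine in `n`. It is expanded at `n = x`, so that in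
a product over the cells the constant terms give the entropy and the linear terms form the sum that
vanishes at a critical point. -/
lemma geomDist_real_singleton {x : ℝ} (hx : 0 < x) (n : ℕ) :
    (geomDist x).real {n} =
      Real.exp (-((x + 1) * Real.log (x + 1) - x * Real.log x)
        - (n - x) * Real.log ((1 + x) / x)) := by
  rw [geomDist, geometricMeasure_real_singleton (projIcc_inv_ne_zero hx), projIcc_inv_coe hx,
    show (1 : ℝ) - 1 / (1 + x) = x / (1 + x) by field_simp; ring, Real.log_div (by positivity)
    hx.ne', add_comm 1 x,
    show -((x + 1) * Real.log (x + 1) - x * Real.log x)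
        - (n - x) * (Real.log (x + 1) - Real.log x) =
      n * (Real.log x - Real.log (x + 1)) + -Real.log (x + 1) by ring, Real.exp_add,
    ← Real.log_div hx.ne' (by positivity), Real.exp_nat_mul, Real.exp_log (by positivity),
    Real.exp_neg, Real.exp_log (by positivity), one_div]

lemma natCharFun_geomDist {x : ℝ} (hx : 0 < x) (θ : ℝ) :
    natCharFun (geomDist x) θ = (1 + x - x * Complex.exp (Complex.I * θ))⁻¹ := by
  rw [natCharFun, geomDist, integral_geometricMeasure (projIcc_inv_ne_zero hx), projIcc_inv_coe hx]
  have h1 : (1 : ℝ) - 1 / (1 + x) = x / (1 + x) := by field_simp; ring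
  have hx1 : (1 + x : ℂ) ≠ 0 := by exact_mod_cast (by positivity : (1 + x : ℝ) ≠ 0)
  have h2 : ∀ n : ℕ, ((1 - 1 / (1 + x) : ℝ) ^ n * (1 / (1 + x))) •
      Complex.exp (Complex.I * (θ * n)) =
      ((x / (1 + x) : ℝ) * Complex.exp (Complex.I * θ)) ^ n * (1 + x : ℂ)⁻¹ := by
    intro n
    rw [h1, Complex.real_smul, mul_pow, ← Complex.exp_nat_mul]
    push_cast
    rw [show (n : ℂ) * (Complex.I * θ) = Complex.I * (θ * n) by ring]
    ring
  simp_rw [h2]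
  rw [tsum_mul_right, tsum_geometric_of_norm_lt_one, ← mul_inv]
  · congr 1
    push_cast
    field_simp
  · rw [norm_mul, mul_comm Complex.I, Complex.norm_exp_ofReal_mul_I, Complex.norm_real,
      Real.norm_of_nonneg (by positivity), mul_one, div_lt_one (by positivity)]
    linarith

lemma bernDist_real_one {x : ℝ} (h0 : 0 ≤ x) (h1 : x ≤ 1) : (bernDist x).real {1} = x := by
  rw [bernDist, bernoulliMeasure_real_apply_of_mem_of_notMem _ (by simp) (by simp) (by simp),
    projIcc_coe_of_mem h0 h1]

lemma bernDist_real_zero {x : ℝ} (h0 : 0 ≤ x) (h1 : x ≤ 1) : (bernDist x).real {0} = 1 - x := by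
  rw [bernDist, bernoulliMeasure_real_apply_of_notMem_of_mem _ (by simp) (by simp) (by simp),
    projIcc_coe_of_mem h0 h1]

lemma bernDist_real_of_two_le (x : ℝ) {n : ℕ} (hn : 2 ≤ n) : (bernDist x).real {n} = 0 := by
  rw [bernDist, bernoulliMeasure_real_apply_of_notMem_of_notMem _ (by simp)
    (by simp; omega) (by simp; omega)]

lemma natCharFun_bernDist {x : ℝ} (h0 : 0 ≤ x) (h1 : x ≤ 1) (θ : ℝ) :
    natCharFun (bernDist x) θ = 1 - x + x * Complex.exp (Complex.I * θ) := by
  rw [natCharFun, bernDist, integral_bernoulliMeasure, projIcc_coe_of_mem h0 h1]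
  simp
  ring

/-- A characteristic function with decay rate `κ` that agrees, up to a cubic relative error with
constant `L`, with that of the Gaussian variable with expectation `z` and variance `w`. -/
def IsNearGaussian (μ : Measure ℕ) (z w κ L : ℝ) : Prop :=
  (∀ θ, ‖natCharFun μ θ‖ ≤ Real.exp (-(κ * (1 - Real.cos θ)))) ∧
    ∀ θ : ℝ, |θ| ≤ 1 →
      ‖natCharFun μ θ * Complex.exp (-(Complex.I * (z * θ)) + w * θ ^ 2 / 2) - 1‖ ≤ L * |θ| ^ 3

lemma exists_isNearGaussian_geomDist {δ : ℝ} (M : ℝ) (hδ : 0 < δ) :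
    ∃ κ L : ℝ, 0 < κ ∧ 0 ≤ L ∧ ∀ x, δ ≤ x → x ≤ M →
      IsNearGaussian (geomDist x) x (x ^ 2 + x) κ L := by
  obtain ⟨L, hL, hLb⟩ := exists_norm_pgf_mul_exp_sub_one_le M
  refine ⟨(δ ^ 2 + δ) / (1 + 4 * (M ^ 2 + |M|)), L * Real.exp ((M ^ 2 + |M|) / 2),
    by positivity, by positivity, fun x hx hxM => ?_⟩
  have hx0 : 0 < x := hδ.trans_le hx
  have hM : |M| = M := abs_of_pos (hx0.trans_le hxM)
  rw [hM]
  set w := x ^ 2 + x with hw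
  have hw0 : 0 < w := by positivity
  have hwl : δ ^ 2 + δ ≤ w := by simp only [hw]; gcongr
  have hwu : w ≤ M ^ 2 + M := by simp only [hw]; gcongr
  have hsq : ∀ θ : ℝ, ‖1 + x - x * Complex.exp (Complex.I * θ)‖ ^ 2 =
      1 + 2 * w * (1 - Real.cos θ) := fun θ => by rw [normSq_pgf]; ring
  have hnn : ∀ θ : ℝ, 0 ≤ 1 - Real.cos θ := fun θ => by linarith [Real.cos_le_one θ]
  have h1le : ∀ θ : ℝ, 1 ≤ ‖1 + x - x * Complex.exp (Complex.I * θ)‖ := by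
    intro θ
    have := hsq θ
    have h2 : 0 ≤ 2 * w * (1 - Real.cos θ) := mul_nonneg (by positivity) (hnn θ)
    by_contra! h
    nlinarith [norm_nonneg (1 + x - x * Complex.exp (Complex.I * θ))]
  constructor
  · intro θ
    rw [natCharFun_geomDist hx0, norm_inv, Real.exp_neg]
    refine inv_anti₀ (Real.exp_pos _) ?_
    refine (pow_le_pow_iff_left₀ (by positivity) (by positivity) two_ne_zero).mp ?_
    rw [hsq, ← Real.exp_nat_mul]
    set s := 1 - Real.cos θ
    have hs : 0 ≤ s := hnn θ
    have hs2 : s ≤ 2 := by simp only [s]; linarith [Real.neg_one_le_cos θ]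
    have hy : 0 < 1 + 2 * w * s := by positivity
    rw [← Real.le_log_iff_exp_le hy]
    -- Since `s ≤ 2`, the bound `log y ≥ 1 - 1/y` at `y = 1 + 2ws` is linear in `s` with a uniform
    -- constant; this is where the denominator of `κ` comes from.
    refine le_trans ?_ (Real.one_sub_inv_le_log_of_pos hy)
    rw [show 1 - (1 + 2 * w * s)⁻¹ = 2 * (w / (1 + 2 * w * s) * s) by field_simp; ring]
    push_cast
    have : (δ ^ 2 + δ) / (1 + 4 * (M ^ 2 + M)) ≤ w / (1 + 2 * w * s) := by
      have : w * s ≤ (M ^ 2 + M) * 2 := mul_le_mul hwu hs2 hs (hw0.le.trans hwu)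
      exact div_le_div₀ hw0.le hwl hy (by linarith)
    gcongr
  · intro θ hθ
    rw [natCharFun_geomDist hx0]
    have hb := hLb x θ (by rw [abs_of_pos hx0]; exact hxM) hθ
    set N := 1 + x - x * Complex.exp (Complex.I * θ)
    have hN : N ≠ 0 := norm_pos_iff.mp (one_pos.trans_le (h1le θ))
    set u := Complex.I * (x * θ) - (x + x ^ 2) * θ ^ 2 / 2 with hu
    have hu' : -(Complex.I * (x * θ)) + (w : ℂ) * θ ^ 2 / 2 = -u := by
      simp only [hu, hw]; push_cast; ring
    rw [hu', show N⁻¹ * Complex.exp (-u) - 1 =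
      -(N⁻¹ * Complex.exp (-u) * (N * Complex.exp u - 1)) by
        rw [mul_sub, show N⁻¹ * Complex.exp (-u) * (N * Complex.exp u) =
          (N⁻¹ * N) * (Complex.exp (-u) * Complex.exp u) by ring, ← Complex.exp_add,
          inv_mul_cancel₀ hN]
        simp]
    rw [norm_neg, norm_mul, norm_mul, norm_inv]
    have h3 : ‖N‖⁻¹ ≤ 1 := inv_le_one_of_one_le₀ (h1le θ)
    have h4 : ‖Complex.exp (-u)‖ ≤ Real.exp ((M ^ 2 + M) / 2) := by
      rw [Complex.norm_exp]
      refine Real.exp_le_exp.mpr ?_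
      have : (-u).re = w * θ ^ 2 / 2 := by
        rw [← hu', show -(Complex.I * (x * θ)) + (w : ℂ) * θ ^ 2 / 2 =
          ((w * θ ^ 2 / 2 : ℝ) : ℂ) + ((-(x * θ) : ℝ) : ℂ) * Complex.I by push_cast; ring,
          Complex.add_re, Complex.ofReal_re, Complex.re_ofReal_mul, Complex.I_re, mul_zero, add_zero]
      rw [this]
      have hθ2 : θ ^ 2 ≤ 1 := (sq_le_one_iff_abs_le_one θ).mpr hθ
      nlinarith
    calc _ ≤ 1 * Real.exp ((M ^ 2 + M) / 2) * (L * |θ| ^ 3) := by gcongr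
      _ = _ := by ring

lemma exists_isNearGaussian_bernDist {δ : ℝ} (hδ : 0 < δ) :
    ∃ κ L : ℝ, 0 < κ ∧ 0 ≤ L ∧ ∀ x, δ ≤ x → x ≤ 1 - δ →
      IsNearGaussian (bernDist x) x (x - x ^ 2) κ L := by
  obtain ⟨L, hL, hLb⟩ := exists_norm_pgf_mul_exp_sub_one_le 1
  refine ⟨δ ^ 2, L, by positivity, hL, fun x hx hxM => ?_⟩
  have hx0 : 0 < x := hδ.trans_le hx
  have hx1 : x ≤ 1 := by linarith
  have hchar : ∀ θ : ℝ, natCharFun (bernDist x) θ =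
      1 + ((-x : ℝ) : ℂ) - ((-x : ℝ) : ℂ) * Complex.exp (Complex.I * θ) := fun θ => by
    rw [natCharFun_bernDist hx0.le hx1]; push_cast; ring
  constructor
  · intro θ
    refine (pow_le_pow_iff_left₀ (by positivity) (by positivity) two_ne_zero).mp ?_
    rw [hchar, normSq_pgf, ← Real.exp_nat_mul]
    have hs : 0 ≤ 1 - Real.cos θ := by linarith [Real.cos_le_one θ]
    have hw : δ ^ 2 ≤ x - x ^ 2 := by nlinarith
    have := mul_le_mul_of_nonneg_right hw hs
    refine le_trans ?_ (Real.add_one_le_exp _)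
    push_cast
    nlinarith
  · intro θ hθ
    rw [hchar]
    convert hLb (-x) θ (by rw [abs_neg, abs_of_pos hx0]; exact hx1) hθ using 4
    push_cast
    ring_nf

end CharFun

/-! ### The linear forms of the table equations -/

section Table

variable {ν : ℕ} {k : Fin ν → ℕ}

/-- The coordinate of `t` that belongs to the section `j` in direction `i`, which is `0` for the
last section. -/
def sectionCoord (k : Fin ν → ℕ) (t : Constraint k → ℝ) (i : Fin ν) (j : Fin (k i)) : ℝ :=
  if h : (j : ℕ) < k i - 1 then t (some ⟨i, ⟨j, h⟩⟩) else 0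

lemma linForm_tableMatrix (t : Constraint k → ℝ) (p : Cell k) :
    linForm (tableMatrix k) t p = t none + ∑ i, sectionCoord k t i (p i) := by
  rw [linForm, Fintype.sum_option, Fintype.sum_sigma]
  congr 1
  · simp [tableMatrix]
  · refine Finset.sum_congr rfl fun i _ => ?_
    simp only [tableMatrix, of_apply, sectionCoord]
    split_ifs with h
    · rw [Finset.sum_eq_single ⟨p i, h⟩]
      · simp
      · intro j _ hj
        rw [if_neg, Int.cast_zero, zero_mul]
        exact fun e => hj (Fin.ext e.symm)
      · simp
    · refine Finset.sum_eq_zero fun j _ => ?_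
      rw [if_neg, Int.cast_zero, zero_mul]
      exact fun e => h (e ▸ j.2)

/-- Moving a cell to section `j` in direction `i` is a map whose fibres have at most `k i` elements.
-/
lemma sum_update_le (i : Fin ν) (j : Fin (k i)) {F : Cell k → ℝ} (hF : ∀ p, 0 ≤ F p) :
    ∑ p : Cell k, F (Function.update p i j) ≤ k i * ∑ p, F p := by
  classical
  rw [Finset.sum_comp F (fun p : Cell k => Function.update p i j), Finset.mul_sum]
  refine (Finset.sum_le_sum fun q _ => ?_).trans
    (Finset.sum_le_sum_of_subset_of_nonneg (Finset.subset_univ _) fun q _ _ =>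
      mul_nonneg (Nat.cast_nonneg _) (hF q))
  rw [nsmul_eq_mul]
  refine mul_le_mul_of_nonneg_right (Nat.cast_le.mpr ?_) (hF q)
  calc _ ≤ (Finset.univ.image fun a : Fin (k i) => Function.update q i a).card := by
        refine Finset.card_le_card fun p hp => ?_
        rw [Finset.mem_filter] at hp
        refine Finset.mem_image.mpr ⟨p i, Finset.mem_univ _, ?_⟩
        rw [← hp.2]
        simp
    _ ≤ k i := Finset.card_image_le.trans (by simp)

variable {f : ℝ → ℝ}

lemma sq_sub_le_of_subadditive (hf0 : ∀ x, 0 ≤ f x)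
    (hadd : ∀ x y, f (x + y) ≤ f x + f y) (hneg : ∀ x, f (-x) = f x) (x y : ℝ) :
    f (x - y) ^ 2 ≤ 2 * (f x ^ 2 + f y ^ 2) := by
  have h := hadd x (-y)
  rw [hneg, ← sub_eq_add_neg] at h
  nlinarith [hf0 (x - y), sq_nonneg (f x - f y), hf0 x, hf0 y]

/-- If a subadditive function is small in the mean on the linear forms, it is small on all
coordinates. -/
lemma subadditive_coord_le (hk : ∀ i, 1 < k i) (hf0 : ∀ x, 0 ≤ f x)
    (hadd : ∀ x y, f (x + y) ≤ f x + f y) (hneg : ∀ x, f (-x) = f x) {s m : ℝ}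
    (hν : 0 < ν) (hm : ∀ i, (k i : ℝ) ≤ m * Fintype.card (Cell k)) (t : Constraint k → ℝ)
    (hs : ∑ p, f (linForm (tableMatrix k) t p) ^ 2 ≤ s) (c : Constraint k) :
    f (t c) ≤ (2 * ν + 1) * Real.sqrt (s * m) := by
  have hne : ∀ i, Nonempty (Fin (k i)) := fun i => ⟨⟨0, by have := hk i; omega⟩⟩
  have hK : 0 < (Fintype.card (Cell k) : ℝ) := Nat.cast_pos.mpr Fintype.card_pos
  have hs0 : 0 ≤ s := (Finset.sum_nonneg fun p _ => sq_nonneg _).trans hs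
  have hm' : 1 / (Fintype.card (Cell k) : ℝ) ≤ m := by
    rw [div_le_iff₀ hK]
    exact le_trans (by exact_mod_cast (hk ⟨0, hν⟩).le) (hm ⟨0, hν⟩)
  have hm0 : 0 ≤ m := le_trans (by positivity) hm'
  have hsec : ∀ i (j : Fin (k i)), f (sectionCoord k t i j) ≤ 2 * Real.sqrt (s * m) := by
    intro i j
    -- The last section has no equation, so its coordinate is `0`. Hence two cells that differ only
    -- in direction `i`, with indices `j` and `l`, have linear forms whose difference is exactly the
    -- coordinate of `(i, j)`. Averaging over all cells gives the bound.
    let l : Fin (k i) := ⟨k i - 1, by have := hk i; omega⟩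
    have hl : sectionCoord k t i l = 0 := by simp [sectionCoord, l]
    have hdiff : ∀ p : Cell k, sectionCoord k t i j =
        linForm (tableMatrix k) t (Function.update p i j)
          - linForm (tableMatrix k) t (Function.update p i l) := by
      intro p
      rw [linForm_tableMatrix, linForm_tableMatrix, add_sub_add_left_eq_sub,
        ← Finset.sum_sub_distrib, Finset.sum_eq_single i]
      · simp [hl]
      · intro i' _ hi'
        rw [Function.update_of_ne hi', Function.update_of_ne hi', sub_self]
      · simp
    have h1 : ∀ p : Cell k, f (sectionCoord k t i j) ^ 2 ≤
        2 * (f (linForm (tableMatrix k) t (Function.update p i j)) ^ 2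
          + f (linForm (tableMatrix k) t (Function.update p i l)) ^ 2) := fun p => by
      rw [hdiff p]
      exact sq_sub_le_of_subadditive hf0 hadd hneg _ _
    have h2 := Finset.sum_le_sum fun p (_ : p ∈ (Finset.univ : Finset (Cell k))) => h1 p
    rw [Finset.sum_const, nsmul_eq_mul, Finset.card_univ, ← Finset.mul_sum,
      Finset.sum_add_distrib] at h2
    have h3 := fun j => sum_update_le i j
      (F := fun p => f (linForm (tableMatrix k) t p) ^ 2) fun p => sq_nonneg _
    have h4 : (k i : ℝ) * ∑ p, f (linForm (tableMatrix k) t p) ^ 2 ≤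
        m * Fintype.card (Cell k) * s :=
      mul_le_mul (hm i) hs (Finset.sum_nonneg fun p _ => sq_nonneg _) (by positivity)
    have h5 : (Fintype.card (Cell k) : ℝ) * f (sectionCoord k t i j) ^ 2 ≤
        Fintype.card (Cell k) * (4 * (s * m)) := by linarith [h3 j, h3 l]
    have h6 := le_of_mul_le_mul_left h5 hK
    have : 2 * Real.sqrt (s * m) = Real.sqrt (4 * (s * m)) := by
      rw [Real.sqrt_mul (x := 4) (by norm_num), show (4 : ℝ) = 2 ^ 2 by norm_num,
        Real.sqrt_sq (by norm_num)]
    rw [this]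
    exact Real.le_sqrt_of_sq_le h6
  rcases c with _ | ⟨i, j⟩
  -- Some cell is no worse than the mean, and `1 / card ≤ m`. The coordinate of the total sum is
  -- recovered from the linear form of that cell by subtracting `ν` section coordinates.
  · obtain ⟨p, hp⟩ : ∃ p : Cell k, f (linForm (tableMatrix k) t p) ^ 2 ≤ s * m := by
      by_contra! h
      have h2 : ∑ _p : Cell k, s * m < ∑ p, f (linForm (tableMatrix k) t p) ^ 2 :=
        Finset.sum_lt_sum_of_nonempty Finset.univ_nonempty fun p _ => h p
      rw [Finset.sum_const, nsmul_eq_mul, Finset.card_univ] at h2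
      have : s ≤ Fintype.card (Cell k) * (s * m) := by
        rw [div_le_iff₀ hK] at hm'
        nlinarith
      linarith
    have h0 : t none = linForm (tableMatrix k) t p + -∑ i, sectionCoord k t i (p i) := by
      rw [linForm_tableMatrix]; ring
    have hsum : f (∑ i, sectionCoord k t i (p i)) ≤ ∑ i, f (sectionCoord k t i (p i)) := by
      have : Nonempty (Fin ν) := ⟨⟨0, hν⟩⟩
      refine Finset.le_sum_nonempty_of_subadditive f hadd Finset.univ_nonempty _
    have hsum2 : ∑ i, f (sectionCoord k t i (p i)) ≤ ν * (2 * Real.sqrt (s * m)) := by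
      refine (Finset.sum_le_sum fun i _ => hsec i (p i)).trans ?_
      simp
    have hp' := Real.le_sqrt_of_sq_le hp
    rw [h0]
    refine (hadd _ _).trans ?_
    rw [hneg]
    linarith
  · have h := hsec i ⟨j, lt_of_lt_of_le j.2 (Nat.sub_le _ _)⟩
    have e : sectionCoord k t i ⟨j, lt_of_lt_of_le j.2 (Nat.sub_le _ _)⟩ = t (some ⟨i, j⟩) := by
      simp [sectionCoord]
    rw [e] at h
    refine h.trans (mul_le_mul_of_nonneg_right ?_ (Real.sqrt_nonneg _))
    have : (1 : ℝ) ≤ ν := by exact_mod_cast hν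
    linarith

lemma abs_linForm_le {T : ℝ} (hT : 0 ≤ T) (t : Constraint k → ℝ) (ht : ∀ c, |t c| ≤ T)
    (p : Cell k) : |linForm (tableMatrix k) t p| ≤ (ν + 1) * T := by
  rw [linForm_tableMatrix]
  have h : ∀ i, |sectionCoord k t i (p i)| ≤ T := fun i => by
    rw [sectionCoord]
    split_ifs
    · exact ht _
    · simpa using hT
  calc _ ≤ |t none| + ∑ i, |sectionCoord k t i (p i)| :=
        (abs_add_le _ _).trans (by gcongr; exact Finset.abs_sum_le_sum_abs _ _)
    _ ≤ T + ∑ _i : Fin ν, T := by gcongr <;> simp_all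
    _ = _ := by simp; ring

/-- The chord `|e^{ix} - 1|`. -/
noncomputable def chord (x : ℝ) : ℝ := ‖Complex.exp (x * Complex.I) - 1‖

lemma chord_sq (x : ℝ) : chord x ^ 2 = 2 * (1 - Real.cos x) := by
  have h : (Complex.exp (x * Complex.I) - 1 : ℂ) = ⟨Real.cos x - 1, Real.sin x⟩ := by
    rw [Complex.exp_mul_I]
    apply Complex.ext <;> simp [Complex.cos_ofReal_re, Complex.sin_ofReal_re]
  rw [chord, h, ← Complex.normSq_eq_norm_sq, Complex.normSq_mk]
  have := Real.sin_sq_add_cos_sq x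
  linear_combination this

lemma chord_nonneg (x : ℝ) : 0 ≤ chord x := norm_nonneg _

lemma chord_neg (x : ℝ) : chord (-x) = chord x := by
  rw [← sq_eq_sq₀ (chord_nonneg _) (chord_nonneg _), chord_sq, chord_sq, Real.cos_neg]

/-- Together with evenness, this makes the coordinate estimate applicable to distances from `2πℤ`.
-/
lemma chord_add_le (x y : ℝ) : chord (x + y) ≤ chord x + chord y := by
  have h : Complex.exp ((x + y : ℝ) * Complex.I) - 1 =
      Complex.exp (x * Complex.I) * (Complex.exp (y * Complex.I) - 1)
        + (Complex.exp (x * Complex.I) - 1) := by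
    push_cast
    rw [add_mul, Complex.exp_add]
    ring
  rw [chord, h]
  refine (norm_add_le _ _).trans ?_
  rw [norm_mul, Complex.norm_exp_ofReal_mul_I, one_mul, add_comm]
  rfl

lemma abs_le_chord {x : ℝ} (hx : |x| ≤ Real.pi) : |x| ≤ Real.pi / 2 * chord x := by
  have h := Real.cos_le_one_sub_mul_cos_sq hx
  have hpi := Real.pi_pos
  refine abs_le_of_sq_le_sq ?_ (mul_nonneg (by positivity) (chord_nonneg x))
  rw [mul_pow, chord_sq]
  have h2 : 2 / Real.pi ^ 2 * x ^ 2 ≤ 1 - Real.cos x := by linarith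
  calc x ^ 2 = (Real.pi / 2) ^ 2 * (2 * (2 / Real.pi ^ 2 * x ^ 2)) := by field_simp
    _ ≤ _ := by gcongr

end Table

/-! ### The local limit theorem for tables -/

section LocalLimit

lemma dotProduct_weightedMatrix_mulVec {D J : Type} [Fintype D] [DecidableEq D] [Fintype J]
    (A : Matrix D J ℤ) {w : J → ℝ} (hw : ∀ j, 0 ≤ w j) (t : D → ℝ) :
    t ⬝ᵥ (weightedMatrix A w * (weightedMatrix A w)ᵀ) *ᵥ t = ∑ j, w j * linForm A t j ^ 2 := by
  rw [← mulVec_mulVec, dotProduct_mulVec, ← mulVec_transpose, dotProduct]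
  refine Finset.sum_congr rfl fun j _ => ?_
  have h : ((weightedMatrix A w)ᵀ *ᵥ t) j = Real.sqrt (w j) * linForm A t j := by
    simp only [mulVec, dotProduct, transpose_apply, weightedMatrix, of_apply, linForm,
      Finset.mul_sum, mul_assoc]
  rw [h, mul_mul_mul_comm, Real.mul_self_sqrt (hw j), sq]

lemma continuous_linForm {D J : Type} [Fintype D] (A : Matrix D J ℤ) (j : J) :
    Continuous fun t => linForm A t j := by
  unfold linForm
  fun_prop

lemma continuous_natCharFun (μ : Measure ℕ) [IsProbabilityMeasure μ] :
    Continuous (natCharFun μ) := by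
  unfold natCharFun
  refine continuous_of_dominated (bound := fun _ => 1) (fun θ => ?_) (fun θ => ?_)
    (integrable_const _) ?_
  · exact (measurable_of_countable _).aestronglyMeasurable
  · refine Filter.Eventually.of_forall fun x => ?_
    rw [show Complex.I * ((θ : ℂ) * x) = ((θ * x : ℝ) : ℂ) * Complex.I by push_cast; ring,
      Complex.norm_exp_ofReal_mul_I]
  · exact Filter.Eventually.of_forall fun x => by fun_prop

variable {ν : ℕ} {k : Fin ν → ℕ}

lemma nonempty_cell (hk : ∀ i, 1 < k i) : Nonempty (Cell k) :=
  ⟨fun i => ⟨0, by have := hk i; omega⟩⟩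

lemma abs_coord_le (hk : ∀ i, 1 < k i) (hν : 0 < ν) {s m : ℝ}
    (hm : ∀ i, (k i : ℝ) ≤ m * Fintype.card (Cell k)) (t : Constraint k → ℝ)
    (hs : ∑ p, linForm (tableMatrix k) t p ^ 2 ≤ s) (c : Constraint k) :
    |t c| ≤ (2 * ν + 1) * Real.sqrt (s * m) :=
  subadditive_coord_le (f := fun x => |x|) hk abs_nonneg abs_add_le abs_neg hν hm t
    (by simpa only [sq_abs] using hs) c

/-- If the quadratic form vanishes at `t`, so do all linear forms, and the coordinate estimate with
`s = 0` gives `t = 0`. -/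
lemma posDef_weightedMatrix (hk : ∀ i, 1 < k i) (hν : 0 < ν) {w : Cell k → ℝ}
    (hw : ∀ p, 0 < w p) :
    (weightedMatrix (tableMatrix k) w * (weightedMatrix (tableMatrix k) w)ᵀ).PosDef := by
  rw [posDef_iff_dotProduct_mulVec]
  refine ⟨?_, fun t ht => ?_⟩
  · rw [← conjTranspose_eq_transpose_of_trivial]
    exact isHermitian_mul_conjTranspose_self _
  · rw [star_trivial, dotProduct_weightedMatrix_mulVec _ fun p => (hw p).le]
    by_contra! h
    have h0 : ∀ p, w p * linForm (tableMatrix k) t p ^ 2 = 0 := by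
      have hn : ∀ p ∈ Finset.univ, 0 ≤ w p * linForm (tableMatrix k) t p ^ 2 :=
        fun p _ => mul_nonneg (hw p).le (sq_nonneg _)
      have := (Finset.sum_eq_zero_iff_of_nonneg hn).mp (le_antisymm h (Finset.sum_nonneg hn))
      exact fun p => this p (Finset.mem_univ p)
    have h1 : ∀ p, linForm (tableMatrix k) t p = 0 := fun p => by
      simpa [(hw p).ne'] using h0 p
    apply ht
    funext c
    have hcard : (1 : ℝ) ≤ Fintype.card (Cell k) := by
      have := nonempty_cell hk
      exact_mod_cast Fintype.card_pos (α := Cell k)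
    have := abs_coord_le hk hν (s := 0) (m := ∑ i, (k i : ℝ)) (fun i => ?_) t
      (by simp [h1]) c
    · simpa using this
    · have h2 : (k i : ℝ) ≤ ∑ i, (k i : ℝ) :=
        Finset.single_le_sum (f := fun i => (k i : ℝ)) (fun i _ => by positivity)
          (Finset.mem_univ i)
      nlinarith [(by positivity : (0 : ℝ) ≤ k i)]

/-- A point of the cube at which the linear forms are small modulo `2π` is close to the origin. -/
lemma sum_sq_linForm_le_of_chord (hk : ∀ i, 1 < k i) (hν : 0 < ν) {s m : ℝ}
    (hs : 0 ≤ s) (hm : ∀ i, (k i : ℝ) ≤ m * Fintype.card (Cell k))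
    (hT : 2 * (ν + 1) * ((2 * ν + 1) * Real.sqrt (s * m)) ≤ 1) {t : Constraint k → ℝ}
    (ht : t ∈ torusCube (Constraint k))
    (hch : ∑ p, chord (linForm (tableMatrix k) t p) ^ 2 ≤ 4 / Real.pi ^ 2 * s) :
    ∑ p, linForm (tableMatrix k) t p ^ 2 ≤ s := by
  have hpi := Real.pi_pos
  have hpi3 := Real.pi_gt_three
  have hpi4 := Real.pi_le_four
  have h4 : 4 / Real.pi ^ 2 * s ≤ s := by
    refine mul_le_of_le_one_left hs ?_
    rw [div_le_one (by positivity)]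
    nlinarith
  set T := (2 * ν + 1) * Real.sqrt (s * m) with hTdef
  have hT0 : 0 ≤ T := by positivity
  -- The chord controls `|x|` only for `|x| ≤ π`. It is used first on the coordinates, which lie in
  -- the cube; the linear forms are then at most `1`, so it applies to them as well.
  have h1 : ∀ c, |t c| ≤ 2 * T := fun c => by
    have hc := subadditive_coord_le hk chord_nonneg chord_add_le chord_neg hν hm t
      (hch.trans h4) c
    have htc := ht c (Set.mem_univ c)
    have := abs_le_chord (abs_le.mpr ⟨htc.1.le, htc.2⟩)
    exact this.trans (mul_le_mul (by linarith) hc (chord_nonneg _) zero_le_two)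
  have h2 : ∀ p, |linForm (tableMatrix k) t p| ≤ Real.pi := fun p => by
    have := abs_linForm_le (by positivity) t h1 p
    linarith
  calc ∑ p, linForm (tableMatrix k) t p ^ 2
      ≤ ∑ p, (Real.pi / 2) ^ 2 * chord (linForm (tableMatrix k) t p) ^ 2 := by
        refine Finset.sum_le_sum fun p _ => ?_
        rw [← mul_pow, ← sq_abs]
        exact pow_le_pow_left₀ (abs_nonneg _) (abs_le_chord (h2 p)) 2
    _ ≤ (Real.pi / 2) ^ 2 * (4 / Real.pi ^ 2 * s) := by
        rw [← Finset.mul_sum]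
        gcongr
    _ = s := by field_simp; ring

variable {μ : Cell k → Measure ℕ} {z w : Cell k → ℝ} {κ L : ℝ}

/-- The integrand of the Fourier inversion formula. -/
noncomputable def tableCharFun (k : Fin ν → ℕ) (μ : Cell k → Measure ℕ) (b : Constraint k → ℤ)
    (t : Constraint k → ℝ) : ℂ :=
  (∏ p, natCharFun (μ p) (linForm (tableMatrix k) t p)) *
    Complex.exp (-(Complex.I * (∑ c, t c * b c : ℝ)))

lemma continuous_tableCharFun [∀ p, IsProbabilityMeasure (μ p)] (b : Constraint k → ℤ) :
    Continuous (tableCharFun k μ b) := by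
  unfold tableCharFun
  have h : ∀ p, Continuous fun t => natCharFun (μ p) (linForm (tableMatrix k) t p) :=
    fun p => (continuous_natCharFun (μ p)).comp (continuous_linForm _ p)
  fun_prop

lemma norm_tableCharFun_le (b : Constraint k → ℤ)
    (hμ : ∀ p, IsNearGaussian (μ p) (z p) (w p) κ L) (t : Constraint k → ℝ) :
    ‖tableCharFun k μ b t‖ ≤
      Real.exp (-(κ / 2 * ∑ p, chord (linForm (tableMatrix k) t p) ^ 2)) := by
  rw [tableCharFun, norm_mul, norm_prod,
    show -(Complex.I * ((∑ c, t c * b c : ℝ) : ℂ)) = ((-∑ c, t c * b c : ℝ) : ℂ) * Complex.I by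
      push_cast; ring, Complex.norm_exp_ofReal_mul_I, mul_one]
  refine (Finset.prod_le_prod (fun p _ => norm_nonneg _) fun p _ => (hμ p).1 _).trans ?_
  rw [← Real.exp_sum, Finset.mul_sum, ← Finset.sum_neg_distrib]
  refine le_of_eq (congrArg _ (Finset.sum_congr rfl fun p _ => ?_))
  rw [chord_sq]
  ring

/-- The linear phases cancel because `b` is the expectation of the sectional sums. Each cell
contributes a relative error `u p` with `‖u p‖ ≤ L |θ p|³`; one factor `|θ p|` is bounded uniformly
and the remaining squares add up to at most `s`. -/
lemma norm_tableCharFun_sub_le (hk : ∀ i, 1 < k i) (hν : 0 < ν) {s m : ℝ} (hL : 0 ≤ L)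
    (hm : ∀ i, (k i : ℝ) ≤ m * Fintype.card (Cell k))
    (hT : 2 * (ν + 1) * ((2 * ν + 1) * Real.sqrt (s * m)) ≤ 1)
    (hμ : ∀ p, IsNearGaussian (μ p) (z p) (w p) κ L) {b : Constraint k → ℤ}
    (hb : ∀ c, ∑ p, (tableMatrix k c p : ℝ) * z p = b c) {t : Constraint k → ℝ}
    (ht : ∑ p, linForm (tableMatrix k) t p ^ 2 ≤ s) :
    ‖tableCharFun k μ b t -
        (Real.exp (-(1 / 2) * ∑ p, w p * linForm (tableMatrix k) t p ^ 2) : ℝ)‖ ≤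
      (Real.exp (L * ((ν + 1) * ((2 * ν + 1) * Real.sqrt (s * m)) * s)) - 1) *
        Real.exp (-(1 / 2) * ∑ p, w p * linForm (tableMatrix k) t p ^ 2) := by
  set T := (2 * ν + 1) * Real.sqrt (s * m) with hTdef
  have hT0 : 0 ≤ T := by positivity
  set θ := linForm (tableMatrix k) t with hθ
  have h1 : ∀ p, |θ p| ≤ (ν + 1) * T :=
    abs_linForm_le hT0 t (abs_coord_le hk hν hm t ht)
  have hθ1 : ∀ p, |θ p| ≤ 1 := fun p => (h1 p).trans (by nlinarith [(by positivity : 0 ≤ (ν + 1) * T)])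
  let u : Cell k → ℂ := fun p => natCharFun (μ p) (θ p) *
    Complex.exp (-(Complex.I * (z p * θ p)) + w p * θ p ^ 2 / 2) - 1
  have hsum : ∑ c, t c * (b c : ℝ) = ∑ p, z p * θ p := by
    simp_rw [← hb, hθ, linForm, Finset.mul_sum]
    rw [Finset.sum_comm]
    exact Finset.sum_congr rfl fun p _ => Finset.sum_congr rfl fun c _ => by ring
  have hF : tableCharFun k μ b t =
      (Real.exp (-(1 / 2) * ∑ p, w p * θ p ^ 2) : ℝ) * ∏ p, (1 + u p) := by
    rw [tableCharFun, hsum]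
    simp only [u, add_sub_cancel]
    rw [Finset.prod_mul_distrib, ← Complex.exp_sum, Complex.ofReal_exp, mul_left_comm,
      ← Complex.exp_add]
    congr 2
    push_cast
    rw [Finset.sum_add_distrib, Finset.sum_neg_distrib, Finset.mul_sum, Finset.mul_sum,
      add_left_comm, ← Finset.sum_add_distrib]
    rw [Finset.sum_eq_zero (s := Finset.univ) (f := fun p => -(1 / 2 : ℂ) * (w p * θ p ^ 2)
      + w p * θ p ^ 2 / 2) fun p _ => by ring, add_zero]
  rw [hF, ← mul_sub_one, norm_mul, Complex.norm_real, Real.norm_of_nonneg (Real.exp_nonneg _),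
    mul_comm]
  refine mul_le_mul_of_nonneg_right ?_ (Real.exp_nonneg _)
  refine (Finset.norm_prod_one_add_sub_one_le _ _).trans ?_
  refine sub_le_sub_right (Real.exp_le_exp.mpr ?_) 1
  calc ∑ p, ‖u p‖ ≤ ∑ p, L * ((ν + 1) * T * θ p ^ 2) := by
        refine Finset.sum_le_sum fun p _ => ((hμ p).2 (θ p) (hθ1 p)).trans ?_
        rw [pow_succ', ← sq_abs (θ p)]
        gcongr
        exact h1 p
    _ = L * ((ν + 1) * T * ∑ p, θ p ^ 2) := by rw [← Finset.mul_sum, ← Finset.mul_sum]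
    _ ≤ _ := by gcongr

/-- A quantitative local limit theorem for the sectional sums of a table with independent
entries. -/
theorem abs_measureReal_table_sub_one_le [∀ p, IsProbabilityMeasure (μ p)]
    (hk : ∀ i, 1 < k i) (hν : 0 < ν) {s m w₀ : ℝ} (hs : 0 ≤ s) (hL : 0 ≤ L) (hκ : 0 ≤ κ)
    (hw₀ : 0 < w₀) (hw : ∀ p, w₀ ≤ w p)
    (hm : ∀ i, (k i : ℝ) ≤ m * Fintype.card (Cell k))
    (hT : 2 * (ν + 1) * ((2 * ν + 1) * Real.sqrt (s * m)) ≤ 1)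
    (hμ : ∀ p, IsNearGaussian (μ p) (z p) (w p) κ L) {b : Constraint k → ℤ}
    (hb : ∀ c, ∑ p, (tableMatrix k c p : ℝ) * z p = b c) {R : ℝ}
    (hR : R = Real.sqrt (2 * Real.pi) ^ Fintype.card (Constraint k) * Real.sqrt
      (weightedMatrix (tableMatrix k) w * (weightedMatrix (tableMatrix k) w)ᵀ).det) :
    |(Measure.pi μ).real {x : Cell k → ℕ | (tableMatrix k *ᵥ fun p => (x p : ℤ)) = b} * R - 1| ≤
      (Real.exp (L * ((ν + 1) * ((2 * ν + 1) * Real.sqrt (s * m)) * s)) - 1)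
        + Real.exp (-(w₀ / 4 * s)) * Real.sqrt 2 ^ Fintype.card (Constraint k)
        + Real.exp (-(2 * κ / Real.pi ^ 2 * s)) * R := by
  set d := Fintype.card (Constraint k)
  set P := (Measure.pi μ).real {x : Cell k → ℕ | (tableMatrix k *ᵥ fun p => (x p : ℤ)) = b}
  set Q := weightedMatrix (tableMatrix k) w * (weightedMatrix (tableMatrix k) w)ᵀ
  have hw0 : ∀ p, 0 < w p := fun p => hw₀.trans_le (hw p)
  have hQ : Q.PosDef := posDef_weightedMatrix hk hν hw0
  have hdet : 0 < Real.sqrt Q.det := Real.sqrt_pos.mpr hQ.det_pos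
  have hpi := Real.pi_pos
  set q : (Constraint k → ℝ) → ℝ := fun t => ∑ p, w p * linForm (tableMatrix k) t p ^ 2 with hq
  have hqQ : ∀ t, t ⬝ᵥ Q *ᵥ t = q t :=
    dotProduct_weightedMatrix_mulVec (tableMatrix k) fun p => (hw0 p).le
  obtain ⟨hE, hEv⟩ := hQ.integral_exp_neg_mul (a := 1 / 2) (by norm_num)
  obtain ⟨hE', hEv'⟩ := hQ.integral_exp_neg_mul (a := 1 / 4) (by norm_num)
  simp_rw [hqQ] at hE hEv hE' hEv'
  set G := Real.sqrt (2 * Real.pi) ^ d / Real.sqrt Q.det with hG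
  have hGpos : 0 < G := by positivity
  rw [show Real.pi / (1 / 2) = 2 * Real.pi by ring, ← hG] at hEv
  rw [show Real.pi / (1 / 4) = 2 * (2 * Real.pi) by ring, Real.sqrt_mul (by norm_num), mul_pow,
    mul_div_assoc, ← hG] at hEv'
  -- `G` is the full Gaussian integral, so the claim is the comparison of `(2π)^d P` with `G`,
  -- divided by `G`.
  have hRG : R * G = (2 * Real.pi) ^ d := by
    rw [hR, hG, mul_div_assoc', div_eq_iff hdet.ne', mul_right_comm, ← mul_pow,
      Real.mul_self_sqrt (by positivity)]
  let U : Set (Constraint k → ℝ) := {t | ∑ p, linForm (tableMatrix k) t p ^ 2 ≤ s}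
  have hcont : Continuous fun t : Constraint k → ℝ => ∑ p, linForm (tableMatrix k) t p ^ 2 :=
    continuous_finsetSum _ fun p _ => (continuous_linForm _ p).pow 2
  have hUm : MeasurableSet U := (isClosed_le hcont continuous_const).measurableSet
  have hUC : U ⊆ torusCube (Constraint k) := by
    intro t ht c _
    have h := abs_le.mp (abs_coord_le hk hν hm t ht c)
    have h2 : 0 ≤ (2 * ν + 1) * Real.sqrt (s * m) := by positivity
    have h3 : (2 * ν + 1) * Real.sqrt (s * m) ≤ 1 := by nlinarith [(Nat.cast_nonneg ν : (0:ℝ) ≤ ν)]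
    have := Real.pi_gt_three
    exact ⟨by linarith, by linarith⟩
  let F := tableCharFun k μ b
  have hFc : Continuous F := continuous_tableCharFun b
  have hFint : IntegrableOn F (torusCube (Constraint k)) := by
    refine Integrable.of_bound (C := 1) hFc.aestronglyMeasurable
      (Filter.Eventually.of_forall fun t => ?_)
    refine (norm_tableCharFun_le b hμ t).trans (Real.exp_le_one_iff.mpr ?_)
    rw [neg_nonpos]
    positivity
  have hfour : (P : ℂ) * (2 * Real.pi) ^ d = ∫ t in torusCube (Constraint k), F t :=
    measureReal_linear_system (tableMatrix k) b μ
  have hsplit : ∫ t in torusCube (Constraint k), F t =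
      (∫ t in U, F t) + ∫ t in torusCube (Constraint k) \ U, F t := by
    rw [setIntegral_sdiff hUm hFint hUC]
    ring
  set E : (Constraint k → ℝ) → ℝ := fun t => Real.exp (-(1 / 2) * q t) with hEdef
  have hsplitE : G = (∫ t in U, E t) + ∫ t in Uᶜ, E t := by
    rw [integral_add_compl hUm hE, hEv]
  set η := Real.exp (L * ((ν + 1) * ((2 * ν + 1) * Real.sqrt (s * m)) * s)) - 1 with hη
  have hη0 : 0 ≤ η := by
    rw [hη, sub_nonneg]
    exact Real.one_le_exp (by positivity)
  have b1 : ‖(∫ t in U, F t) - ((∫ t in U, E t : ℝ) : ℂ)‖ ≤ η * G := by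
    have hEc : IntegrableOn (fun t => (E t : ℂ)) U := hE.integrableOn.ofReal
    rw [← integral_complex_ofReal, ← integral_sub (hFint.mono_set hUC) hEc]
    calc _ ≤ ∫ t in U, η * E t := by
          refine norm_integral_le_of_norm_le (hE.integrableOn.const_mul η) ?_
          refine (ae_restrict_iff' hUm).mpr (Filter.Eventually.of_forall fun t ht => ?_)
          exact norm_tableCharFun_sub_le hk hν hL hm hT hμ hb ht
      _ = η * ∫ t in U, E t := integral_const_mul _ _
      _ ≤ η * G := by
          refine mul_le_mul_of_nonneg_left ?_ hη0
          rw [← hEv]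
          exact setIntegral_le_integral hE (Filter.Eventually.of_forall fun t => Real.exp_nonneg _)
  have b2 : ‖∫ t in torusCube (Constraint k) \ U, F t‖ ≤
      Real.exp (-(2 * κ / Real.pi ^ 2 * s)) * (2 * Real.pi) ^ d := by
    have hvol : volume.real (torusCube (Constraint k)) = (2 * Real.pi) ^ d := by
      rw [measureReal_def, volume_torusCube, ENNReal.toReal_pow,
        ENNReal.toReal_ofReal (by positivity)]
    have hfin : volume (torusCube (Constraint k)) < ⊤ := by
      rw [volume_torusCube]
      exact ENNReal.pow_lt_top ENNReal.ofReal_lt_top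
    refine (norm_setIntegral_le_of_norm_le_const
      ((measure_mono Set.sdiff_subset).trans_lt hfin) fun t ht => ?_).trans
      (mul_le_mul_of_nonneg_left (b := volume.real (torusCube (Constraint k) \ U)) ?_
        (Real.exp_nonneg _))
    · refine (norm_tableCharFun_le b hμ t).trans (Real.exp_le_exp.mpr (neg_le_neg ?_))
      have h : 4 / Real.pi ^ 2 * s ≤ ∑ p, chord (linForm (tableMatrix k) t p) ^ 2 := by
        by_contra! h
        exact ht.2 (sum_sq_linForm_le_of_chord hk hν hs hm hT ht.1 h.le)
      calc 2 * κ / Real.pi ^ 2 * s = κ / 2 * (4 / Real.pi ^ 2 * s) := by ring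
        _ ≤ _ := by gcongr
    · rw [← hvol]
      exact measureReal_mono Set.sdiff_subset hfin.ne
  -- Half of the exponent `q / 2` supplies the smallness off `U`; the other half is integrated over
  -- the whole space, which costs the factor `√2 ^ d`.
  have b3 : ∫ t in Uᶜ, E t ≤ Real.exp (-(w₀ / 4 * s)) * (Real.sqrt 2 ^ d * G) := by
    calc ∫ t in Uᶜ, E t ≤ ∫ t in Uᶜ, Real.exp (-(w₀ / 4 * s)) * Real.exp (-(1 / 4) * q t) := by
          refine setIntegral_mono_on hE.integrableOn (hE'.integrableOn.const_mul _) hUm.compl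
            fun t ht => ?_
          rw [← Real.exp_add]
          refine Real.exp_le_exp.mpr ?_
          have h1 : s < ∑ p, linForm (tableMatrix k) t p ^ 2 := not_le.mp ht
          have h2 : w₀ * ∑ p, linForm (tableMatrix k) t p ^ 2 ≤ q t := by
            rw [hq, Finset.mul_sum]
            exact Finset.sum_le_sum fun p _ => mul_le_mul_of_nonneg_right (hw p) (sq_nonneg _)
          nlinarith
      _ = Real.exp (-(w₀ / 4 * s)) * ∫ t in Uᶜ, Real.exp (-(1 / 4) * q t) :=
          integral_const_mul _ _
      _ ≤ _ := by
          rw [← hEv']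
          exact mul_le_mul_of_nonneg_left (setIntegral_le_integral hE'
            (Filter.Eventually.of_forall fun t => Real.exp_nonneg _)) (Real.exp_nonneg _)
  have b3' : 0 ≤ ∫ t in Uᶜ, E t := integral_nonneg fun t => Real.exp_nonneg _
  have hmain : |P * (2 * Real.pi) ^ d - G| ≤ η * G +
      Real.exp (-(w₀ / 4 * s)) * (Real.sqrt 2 ^ d * G) +
      Real.exp (-(2 * κ / Real.pi ^ 2 * s)) * (2 * Real.pi) ^ d := by
    rw [← Real.norm_eq_abs, ← Complex.norm_real]
    have : ((P * (2 * Real.pi) ^ d - G : ℝ) : ℂ) =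
        ((∫ t in U, F t) - ((∫ t in U, E t : ℝ) : ℂ)) - ((∫ t in Uᶜ, E t : ℝ) : ℂ)
          + ∫ t in torusCube (Constraint k) \ U, F t := by
      rw [hsplitE]
      push_cast
      rw [hfour, hsplit]
      ring
    rw [this]
    refine (norm_add_le _ _).trans (add_le_add ((norm_sub_le _ _).trans (add_le_add b1 ?_)) b2)
    rw [Complex.norm_real, Real.norm_of_nonneg b3']
    exact b3
  rw [← hRG] at hmain
  have : P * (R * G) - G = (P * R - 1) * G := by ring
  rw [this, abs_mul, abs_of_pos hGpos] at hmain
  refine le_of_mul_le_mul_right (hmain.trans_eq ?_) hGpos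
  ring

end LocalLimit

/-! ### Asymptotics of the local limit theorem -/

section Asymptotics

open Filter Topology

lemma tendsto_exp_neg_pow_add {α : ℝ} (hα : 0 < α) (a : ℝ) :
    Tendsto (fun y : ℝ => Real.exp (-(α * y ^ 10)) * Real.exp (a * y ^ 9)) atTop (𝓝 0) := by
  simp_rw [← Real.exp_add]
  refine Real.tendsto_exp_atBot.comp ?_
  have h1 : Tendsto (fun y : ℝ => y ^ 9 * (α * y - a)) atTop atTop :=
    (tendsto_pow_atTop (by norm_num)).atTop_mul_atTop₀
      (tendsto_atTop_add_const_right _ _ (tendsto_id.const_mul_atTop hα))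
  refine (tendsto_neg_atTop_atBot.comp h1).congr fun y => ?_
  simp only [Function.comp]
  ring

variable {ν : ℕ} {k : Fin ν → ℕ}

lemma card_cell_cast : (Fintype.card (Cell k) : ℝ) = ∏ i, (k i : ℝ) := by
  simp [Cell, Fintype.card_pi]

lemma card_constraint_cast (hk : ∀ i, 1 < k i) :
    (Fintype.card (Constraint k) : ℝ) = 1 + ∑ i, ((k i : ℝ) - 1) := by
  simp only [Constraint, Fintype.card_option, Fintype.card_sigma, Fintype.card_fin]
  push_cast
  rw [add_comm]
  congr 1
  refine Finset.sum_congr rfl fun i _ => ?_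
  rw [Nat.cast_sub (hk i).le, Nat.cast_one]

lemma card_constraint_le {C Y : ℝ} (hY : 1 ≤ Y) (hk : ∀ i, 1 < k i)
    (hkC : ∀ i, (k i : ℝ) ≤ C * Y) : (Fintype.card (Constraint k) : ℝ) ≤ (1 + ν * C) * Y := by
  rw [card_constraint_cast hk]
  calc 1 + ∑ i, ((k i : ℝ) - 1) ≤ Y + ∑ _i : Fin ν, C * Y := by
        gcongr with i
        linarith [hkC i]
    _ = _ := by simp; ring

lemma abs_tableMatrix_le (c : Constraint k) (p : Cell k) : |(tableMatrix k c p : ℝ)| ≤ 1 := by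
  rcases c with _ | ⟨i, j⟩
  · simp [tableMatrix]
  · simp only [tableMatrix, of_apply]
    split_ifs <;> simp

/-- The Leibniz expansion, with each entry of the Gram matrix at most the number of cells times `W`.
-/
lemma det_weightedMatrix_le {w : Cell k → ℝ} {W : ℝ} (hw0 : ∀ p, 0 ≤ w p) (hw : ∀ p, w p ≤ W) :
    (weightedMatrix (tableMatrix k) w * (weightedMatrix (tableMatrix k) w)ᵀ).det ≤
      (Fintype.card (Constraint k) * (Fintype.card (Cell k) * W)) ^
        Fintype.card (Constraint k) := by
  have h := det_le (A := weightedMatrix (tableMatrix k) w * (weightedMatrix (tableMatrix k) w)ᵀ)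
    (abv := AbsoluteValue.abs) (x := Fintype.card (Cell k) * W) fun c c' => ?_
  · refine (le_abs_self _).trans (h.trans ?_)
    rcases isEmpty_or_nonempty (Cell k) with hK | ⟨⟨p⟩⟩
    · rw [Fintype.card_eq_zero (α := Cell k)]
      simp
    · have hW : 0 ≤ W := (hw0 p).trans (hw p)
      rw [nsmul_eq_mul, mul_pow (Fintype.card (Constraint k) : ℝ)]
      exact mul_le_mul_of_nonneg_right (by exact_mod_cast Nat.factorial_le_pow _) (by positivity)
  · rw [AbsoluteValue.abs_apply, mul_apply]
    refine (Finset.abs_sum_le_sum_abs _ _).trans ?_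
    refine (Finset.sum_le_card_nsmul _ _ W fun p _ => ?_).trans_eq
      (by rw [nsmul_eq_mul, Finset.card_univ])
    simp only [weightedMatrix, transpose_apply, of_apply]
    rw [mul_mul_mul_comm, Real.mul_self_sqrt (hw0 p), abs_mul, abs_mul, abs_of_nonneg (hw0 p)]
    have h1 := abs_tableMatrix_le c p
    have h2 := abs_tableMatrix_le c' p
    calc w p * (|(tableMatrix k c p : ℝ)| * |(tableMatrix k c' p : ℝ)|) ≤ w p * (1 * 1) := by
          gcongr
          exact hw0 p
      _ ≤ W := by simpa using hw p

/-- A crude bound suffices: there are `O(y^8)` equations, and each costs a power of `y`, which is at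
most `e^{O(y)}`. The result will be compared with a decay `e^{-const · y^10}`. -/
lemma sqrt_det_weightedMatrix_le {w : Cell k → ℝ} {W C y : ℝ} (hy : 1 ≤ y) (hC : 1 ≤ C)
    (hW : 1 ≤ W) (hk : ∀ i, 1 < k i) (hkC : ∀ i, (k i : ℝ) ≤ C * y ^ 8)
    (hw0 : ∀ p, 0 ≤ w p) (hw : ∀ p, w p ≤ W) :
    Real.sqrt (2 * Real.pi) ^ Fintype.card (Constraint k) * Real.sqrt
      (weightedMatrix (tableMatrix k) w * (weightedMatrix (tableMatrix k) w)ᵀ).det ≤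
      Real.exp ((1 + ν * C) * (8 * (1 + ν * C) * (C ^ ν * W) + (8 * ν + 8)) * y ^ 9) := by
  set d := Fintype.card (Constraint k) with hd
  set X := 8 * (1 + ν * C) * (C ^ ν * W) with hX
  have hX0 : 0 ≤ X := by positivity
  have hy8 : 1 ≤ y ^ 8 := one_le_pow₀ hy
  have hdle : (d : ℝ) ≤ (1 + ν * C) * y ^ 8 := card_constraint_le hy8 hk hkC
  have hKle : (Fintype.card (Cell k) : ℝ) ≤ (C * y ^ 8) ^ ν := by
    rw [card_cell_cast]
    refine (Finset.prod_le_prod (fun i _ => by positivity) fun i _ => hkC i).trans_eq ?_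
    simp
  have hbase : 2 * Real.pi * (d * (Fintype.card (Cell k) * W)) ≤ Real.exp ((X + (8 * ν + 8)) * y) := by
    calc 2 * Real.pi * (d * (Fintype.card (Cell k) * W))
        ≤ 2 * 4 * ((1 + ν * C) * y ^ 8 * ((C * y ^ 8) ^ ν * W)) := by
          gcongr
          exact Real.pi_le_four
      _ = X * y ^ (8 * ν + 8) := by rw [hX]; ring
      _ ≤ Real.exp X * Real.exp y ^ (8 * ν + 8) := by
          have h1 := Real.add_one_le_exp X
          have h2 := Real.add_one_le_exp y
          gcongr <;> linarith
      _ = Real.exp (X + (8 * ν + 8) * y) := by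
          rw [← Real.exp_nat_mul, ← Real.exp_add]
          push_cast
          ring_nf
      _ ≤ _ := by
          refine Real.exp_le_exp.mpr ?_
          nlinarith
  have hpi := Real.pi_pos
  set V := Real.exp ((1 + ν * C) * (X + (8 * ν + 8)) * y ^ 9) with hV
  have hV1 : 1 ≤ V := Real.one_le_exp (by positivity)
  have hdet : 0 ≤ (weightedMatrix (tableMatrix k) w * (weightedMatrix (tableMatrix k) w)ᵀ).det := by
    rw [← conjTranspose_eq_transpose_of_trivial]
    exact (posSemidef_self_mul_conjTranspose _).det_nonneg
  refine le_of_abs_le (abs_le_of_sq_le_sq ?_ (zero_le_one.trans hV1))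
  rw [mul_pow, Real.sq_sqrt hdet, ← pow_mul, mul_comm d 2, pow_mul, Real.sq_sqrt (by positivity)]
  refine le_trans ?_ (le_self_pow₀ hV1 two_ne_zero)
  calc _ ≤ (2 * Real.pi) ^ d * (d * (Fintype.card (Cell k) * W)) ^ d := by
        gcongr
        exact det_weightedMatrix_le hw0 hw
    _ = (2 * Real.pi * (d * (Fintype.card (Cell k) * W))) ^ d := by rw [← mul_pow]
    _ ≤ Real.exp ((X + (8 * ν + 8)) * y) ^ d := by gcongr
    _ = Real.exp (d * ((X + (8 * ν + 8)) * y)) := (Real.exp_nat_mul _ _).symm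
    _ ≤ Real.exp ((1 + ν * C) * y ^ 8 * ((X + (8 * ν + 8)) * y)) := by gcongr
    _ = _ := by rw [hV]; ring_nf

/-- The local limit theorem for tables all of whose sides have the same order of magnitude. -/
theorem table_local_limit (hν : 5 ≤ ν) {c w₀ κ L ε : ℝ} (C W : ℝ) (hc : 0 < c) (hw₀ : 0 < w₀)
    (hκ : 0 < κ) (hL : 0 ≤ L) (hε : 0 < ε) :
    ∃ n₀ : ℕ, ∀ n : ℕ, n₀ ≤ n → ∀ k : Fin ν → ℕ, (∀ i, 1 < k i) →
      (∀ i, c * n ≤ k i ∧ (k i : ℝ) ≤ C * n) →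
      ∀ (μ : Cell k → Measure ℕ) (_ : ∀ p, IsProbabilityMeasure (μ p)) (z w : Cell k → ℝ),
      (∀ p, w₀ ≤ w p ∧ w p ≤ W) → (∀ p, IsNearGaussian (μ p) (z p) (w p) κ L) →
      ∀ b : Constraint k → ℤ, (∀ c, ∑ p, (tableMatrix k c p : ℝ) * z p = b c) →
      |(Measure.pi μ).real {x : Cell k → ℕ | (tableMatrix k *ᵥ fun p => (x p : ℤ)) = b} *
        (Real.sqrt (2 * Real.pi) ^ Fintype.card (Constraint k) * Real.sqrt
          (weightedMatrix (tableMatrix k) w * (weightedMatrix (tableMatrix k) w)ᵀ).det) - 1|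
        ≤ ε := by
  let C' := max C 1
  let W' := max W 1
  have hC' : 1 ≤ C' := le_max_right _ _
  have hW' : 1 ≤ W' := le_max_right _ _
  let A := Real.sqrt (C' / c ^ ν)
  have hA : 0 ≤ A := Real.sqrt_nonneg _
  let a₂ : ℝ := 1 + ν * C'
  let a₃ : ℝ := (1 + ν * C') * (8 * (1 + ν * C') * (C' ^ ν * W') + (8 * ν + 8))
  have hlim : Tendsto (fun y : ℝ =>
      (Real.exp (L * ((ν + 1) * ((2 * ν + 1) * A)) / y) - 1)
        + Real.exp (-(w₀ / 4 * y ^ 10)) * Real.exp (a₂ * y ^ 9)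
        + Real.exp (-(2 * κ / Real.pi ^ 2 * y ^ 10)) * Real.exp (a₃ * y ^ 9)) atTop (𝓝 0) := by
    have h1 : Tendsto (fun y : ℝ => Real.exp (L * ((ν + 1) * ((2 * ν + 1) * A)) / y) - 1)
        atTop (𝓝 0) := by
      have h := (Real.continuous_exp.tendsto 0).comp
        (tendsto_const_nhds (x := L * ((ν + 1) * ((2 * ν + 1) * A))).div_atTop tendsto_id)
      rw [Real.exp_zero] at h
      simpa using h.sub_const 1
    have h2 := tendsto_exp_neg_pow_add (α := w₀ / 4) (by positivity) a₂
    have h3 := tendsto_exp_neg_pow_add (α := 2 * κ / Real.pi ^ 2)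
      (by have := Real.pi_pos; positivity) a₃
    simpa using (h1.add h2).add h3
  have hlim2 : Tendsto (fun y : ℝ => 2 * (ν + 1) * ((2 * ν + 1) * A) / y ^ 11) atTop (𝓝 0) :=
    tendsto_const_nhds.div_atTop (tendsto_pow_atTop (by norm_num))
  -- With `n = y^8` the relevant scales `s = n^{5/4}` and `m` of order `n^{-4}` are integer powers
  -- of `y`.
  have hroot : Tendsto (fun n : ℕ => (n : ℝ) ^ (1 / 8 : ℝ)) atTop atTop :=
    (tendsto_rpow_atTop (by norm_num)).comp tendsto_natCast_atTop_atTop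
  have hev := hroot.eventually ((hlim.eventually (eventually_le_nhds hε)).and
    ((hlim2.eventually (eventually_le_nhds one_pos)).and (eventually_ge_atTop 1)))
  obtain ⟨n₀, hn₀⟩ := eventually_atTop.mp hev
  refine ⟨n₀, fun n hn k hk hkn μ _ z w hw hμ b hb => ?_⟩
  obtain ⟨h1, h2, hy⟩ := hn₀ n hn
  set y := (n : ℝ) ^ (1 / 8 : ℝ) with hydef
  have hyn : (n : ℝ) = y ^ 8 := by
    rw [hydef, ← Real.rpow_natCast, ← Real.rpow_mul (by positivity)]
    norm_num
  have hy0 : 0 < y := by linarith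
  have hkC : ∀ i, (k i : ℝ) ≤ C' * y ^ 8 := fun i => by
    refine (hkn i).2.trans ?_
    rw [hyn]
    gcongr
    exact le_max_left _ _
  have hw0 : ∀ p, 0 ≤ w p := fun p => hw₀.le.trans (hw p).1
  have hsq : Real.sqrt (y ^ 10 * (C' / c ^ ν / y ^ 32)) = A / y ^ 11 := by
    rw [show y ^ 10 * (C' / c ^ ν / y ^ 32) = C' / c ^ ν / (y ^ 11) ^ 2 by field_simp,
      Real.sqrt_div (by positivity), Real.sqrt_sq (by positivity)]
  -- Here `√(s m) = A / y^11`, so the cubic error `s √(s m)` is `O(1/y)`, while the tails `e^{-const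
  -- · y^10}` beat the factors `e^{O(y^9)}`.
  have hmain := abs_measureReal_table_sub_one_le (s := y ^ 10) (m := C' / c ^ ν / y ^ 32)
    (b := b) hk (by omega) (by positivity) hL hκ.le hw₀ (fun p => (hw p).1) (fun i => ?_) ?_ hμ hb rfl
  · refine hmain.trans (le_trans ?_ h1)
    rw [hsq]
    refine add_le_add (add_le_add (sub_le_sub_right (Real.exp_le_exp.mpr ?_) 1) ?_) ?_
    · refine le_of_eq ?_
      field_simp
    · refine mul_le_mul_of_nonneg_left ?_ (Real.exp_nonneg _)
      have hsqrt : Real.sqrt 2 ≤ Real.exp 1 :=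
        (Real.sqrt_le_sqrt (by norm_num : (2 : ℝ) ≤ 2 ^ 2)).trans
          (by rw [Real.sqrt_sq zero_le_two]; linarith [Real.add_one_le_exp 1])
      have hd := card_constraint_le (one_le_pow₀ hy) hk hkC
      calc Real.sqrt 2 ^ Fintype.card (Constraint k) ≤ Real.exp 1 ^ Fintype.card (Constraint k) := by
            gcongr
        _ = Real.exp (Fintype.card (Constraint k)) := by rw [← Real.exp_nat_mul, mul_one]
        _ ≤ Real.exp (a₂ * y ^ 9) := by
            refine Real.exp_le_exp.mpr (hd.trans ?_)
            refine mul_le_mul_of_nonneg_left (pow_le_pow_right₀ hy (by norm_num)) (by positivity)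
    · refine mul_le_mul_of_nonneg_left ?_ (Real.exp_nonneg _)
      exact sqrt_det_weightedMatrix_le hy hC' hW' hk hkC hw0
        fun p => (hw p).2.trans (le_max_left _ _)
  · refine (hkC i).trans ?_
    have hKge : (c * y ^ 8) ^ ν ≤ (Fintype.card (Cell k) : ℝ) := by
      rw [card_cell_cast]
      refine le_trans (le_of_eq ?_) (Finset.prod_le_prod (f := fun _ => c * y ^ 8)
        (fun i _ => by positivity) fun i _ => ?_)
      · simp
      · rw [← hyn]; exact (hkn i).1
    -- This needs `8 ≤ 8ν - 32`, that is, `ν ≥ 5`.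
    calc C' * y ^ 8 ≤ C' * y ^ (8 * ν - 32) := by
          gcongr
          omega
      _ = C' / c ^ ν / y ^ 32 * (c * y ^ 8) ^ ν := by
          rw [mul_pow, ← pow_mul, show 8 * ν = (8 * ν - 32) + 32 by omega, pow_add,
            show 8 * ν - 32 + 32 - 32 = 8 * ν - 32 by omega]
          field_simp
      _ ≤ _ := by gcongr
  · rw [hsq]
    refine le_trans (le_of_eq ?_) h2
    ring

end Asymptotics

/-! ### The lattice and the determinant of the table equations -/

section Lattice

variable {ν : ℕ} {k : Fin ν → ℕ}

lemma tableMatrix_mulVec_single (p : Cell k) (c : Constraint k) :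
    (tableMatrix k *ᵥ Pi.single p 1) c = tableMatrix k c p := by
  simp

/-- The column of the cell with all indices last is the unit vector of the total sum. Changing its
index in direction `i` to `j` adds the unit vector of `(i, j)`. So the columns generate `ℤ^d`. -/
lemma imageLattice_tableMatrix (hk : ∀ i, 1 < k i) :
    imageLattice (tableMatrix k) =
      Submodule.span ℤ (Set.range (Pi.basisFun ℝ (Constraint k))) := by
  apply le_antisymm
  · refine Submodule.span_le.mpr ?_
    rintro _ ⟨y, rfl⟩
    rw [SetLike.mem_coe, Module.Basis.mem_span_iff_repr_mem]
    intro c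
    exact ⟨(tableMatrix k *ᵥ y) c, by simp⟩
  · refine Submodule.span_le.mpr ?_
    rintro _ ⟨c, rfl⟩
    let l : Cell k := fun i => ⟨k i - 1, by have := hk i; omega⟩
    refine Submodule.subset_span ?_
    rcases c with _ | ⟨i, j⟩
    · refine ⟨Pi.single l 1, ?_⟩
      funext c
      simp only [tableMatrix_mulVec_single, Pi.basisFun_apply]
      rcases c with _ | ⟨i', j'⟩
      · simp [tableMatrix]
      · have : k i' - 1 ≠ (j' : ℕ) := j'.2.ne'
        simp [tableMatrix, l, this]
    · refine ⟨Pi.single (Function.update l i ⟨j, j.2.trans_le (Nat.sub_le _ _)⟩) 1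
        - Pi.single l 1, ?_⟩
      funext c
      simp only [mulVec_sub, Pi.sub_apply, tableMatrix_mulVec_single, Pi.basisFun_apply]
      rcases c with _ | ⟨i', j'⟩
      · simp [tableMatrix]
      · have hj' : k i' - 1 ≠ (j' : ℕ) := j'.2.ne'
        by_cases hi : i' = i
        · subst hi
          by_cases hj : j' = j
          · subst hj
            simp [tableMatrix, l, hj']
          · have hj2 : (j : ℕ) ≠ j' := fun h => hj (Fin.ext h.symm)
            simp [tableMatrix, l, hj', hj2, hj]
        · simp [tableMatrix, l, hj', hi]

lemma covolume_imageLattice_tableMatrix (hk : ∀ i, 1 < k i) :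
    ZLattice.covolume (imageLattice (tableMatrix k)) = 1 := by
  rw [imageLattice_tableMatrix hk,
    ZLattice.covolume_eq_measure_fundamentalDomain _ _
      (ZSpan.isAddFundamentalDomain (Pi.basisFun ℝ (Constraint k)) volume),
    ZSpan.fundamentalDomain_pi_basisFun, measureReal_def, volume_pi_pi]
  simp

lemma card_filter_cell_eq (s : Finset (Fin ν)) (x : Cell k) :
    (Finset.univ.filter fun p : Cell k => ∀ i ∈ s, p i = x i).card = ∏ i ∈ sᶜ, k i := by
  classical
  have : (Finset.univ.filter fun p : Cell k => ∀ i ∈ s, p i = x i) =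
      Fintype.piFinset fun i => if i ∈ s then {x i} else Finset.univ := by
    ext p
    simp only [Finset.mem_filter, Finset.mem_univ, true_and, Fintype.mem_piFinset]
    refine forall_congr' fun i => ?_
    split_ifs with h <;> simp [h]
  rw [this, Fintype.card_piFinset, ← Finset.prod_mul_prod_compl s, Finset.prod_eq_one, one_mul]
  · refine Finset.prod_congr rfl fun i hi => ?_
    rw [if_neg (Finset.mem_compl.mp hi)]
    simp
  · intro i hi
    rw [if_pos hi]
    simp

end Lattice

/-! ### The Gram determinant of the equations for equal sides -/

section Determinant

variable {ν k : ℕ}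

lemma sum_section_indicator (i : Fin ν) (j : Fin (k - 1)) :
    ∑ p : Cell (fun _ : Fin ν => k), (if (p i : ℕ) = j then (1 : ℤ) else 0) = k ^ (ν - 1) := by
  let x : Cell (fun _ : Fin ν => k) := fun _ => ⟨j, j.2.trans_le (Nat.sub_le _ _)⟩
  have h := card_filter_cell_eq {i} x
  rw [Finset.prod_const, Finset.card_compl, Finset.card_singleton, Fintype.card_fin] at h
  rw [Finset.sum_boole]
  norm_cast
  rw [← h]
  congr 1
  ext p
  simp only [Finset.mem_filter, Finset.mem_univ, true_and, Finset.mem_singleton, forall_eq, x]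
  rw [Fin.ext_iff]

lemma sum_two_section_indicator {i i' : Fin ν} (hi : i ≠ i') (j j' : Fin (k - 1)) :
    ∑ p : Cell (fun _ : Fin ν => k),
      (if (p i : ℕ) = j then (1 : ℤ) else 0) * (if (p i' : ℕ) = j' then 1 else 0) =
        k ^ (ν - 2) := by
  let x : Cell (fun _ : Fin ν => k) := fun a =>
    if a = i then ⟨j, j.2.trans_le (Nat.sub_le _ _)⟩ else ⟨j', j'.2.trans_le (Nat.sub_le _ _)⟩
  have h := card_filter_cell_eq {i, i'} x
  rw [Finset.prod_const, Finset.card_compl, Finset.card_pair hi, Fintype.card_fin] at h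
  simp_rw [ite_zero_mul_ite_zero, mul_one]
  rw [Finset.sum_boole]
  norm_cast
  rw [← h]
  congr 1
  ext p
  simp only [Finset.mem_filter, Finset.mem_univ, true_and, Finset.mem_insert,
    Finset.mem_singleton, forall_eq_or_imp, forall_eq, x, if_true, if_neg hi.symm]
  rw [Fin.ext_iff, Fin.ext_iff]

/-- The determinant of `A Aᵀ` for `k × … × k` tables. -/
theorem det_tableMatrix_mul_transpose (hν : 2 ≤ ν) (hk : 1 < k) :
    (tableMatrix (fun _ : Fin ν => k) * (tableMatrix (fun _ : Fin ν => k))ᵀ).det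
      = (k : ℤ) ^ ((ν ^ 2 - ν) * (k - 1)) := by
  set A := tableMatrix (fun _ : Fin ν => k)
  have hk0 : (k : ℚ) ≠ 0 := by positivity
  have hnn : (A * Aᵀ) none none = k ^ ν := by
    simp [A, mul_apply, tableMatrix, Cell]
  have hsn : ∀ a, (A * Aᵀ) (some a) none = k ^ (ν - 1) := fun ⟨i, j⟩ => by
    simp only [A, mul_apply, transpose_apply, tableMatrix, of_apply, mul_one]
    exact sum_section_indicator i j
  have hns : ∀ a, (A * Aᵀ) none (some a) = k ^ (ν - 1) := fun ⟨i, j⟩ => by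
    simp only [A, mul_apply, transpose_apply, tableMatrix, of_apply, one_mul]
    exact sum_section_indicator i j
  have hss : ∀ a b : (_ : Fin ν) × Fin (k - 1), (A * Aᵀ) (some a) (some b) =
      if a.1 = b.1 then (if a.2 = b.2 then (k : ℤ) ^ (ν - 1) else 0) else k ^ (ν - 2) := by
    rintro ⟨i, j⟩ ⟨i', j'⟩
    simp only [A, mul_apply, transpose_apply, tableMatrix, of_apply]
    split_ifs with h1 h2
    · subst h1 h2
      simp_rw [ite_zero_mul_ite_zero, mul_one, and_self]
      exact sum_section_indicator i j
    · subst h1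
      refine Finset.sum_eq_zero fun p _ => ?_
      rw [ite_zero_mul_ite_zero, if_neg]
      exact fun h => h2 (Fin.ext (h.1.symm.trans h.2))
    · exact sum_two_section_indicator h1 j j'
  suffices h : (((A * Aᵀ).map (Int.castRingHom ℚ)).det) = (k : ℚ) ^ ((ν ^ 2 - ν) * (k - 1)) by
    rw [← RingHom.mapMatrix_apply, ← RingHom.map_det] at h
    rw [eq_intCast] at h
    exact_mod_cast h
  -- The total sum is split off as the last block. The direction is the second component because
  -- `blockDiagonal` takes its block index there.
  let e : (Fin (k - 1) × Fin ν) ⊕ Unit ≃ Constraint (fun _ : Fin ν => k) :=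
    ((Equiv.sumCongr ((Equiv.prodComm _ _).trans (Equiv.sigmaEquivProd _ _).symm)
      (Equiv.refl Unit))).trans (Equiv.optionEquivSumPUnit _).symm
  rw [← det_submatrix_equiv_self e]
  let X : Matrix (Fin (k - 1)) (Fin (k - 1)) ℚ :=
    (k : ℚ) ^ (ν - 1) • (1 + replicateCol Unit (fun _ : Fin (k - 1) => -(1 / k : ℚ)) *
      replicateRow Unit (fun _ : Fin (k - 1) => (1 : ℚ)))
  let B : Matrix (Fin (k - 1) × Fin ν) Unit ℚ := of fun _ _ => (k : ℚ) ^ (ν - 1)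
  let Dm : Matrix Unit Unit ℚ := of fun _ _ => (k : ℚ) ^ ν
  have hDdet : Dm.det = k ^ ν := by simp [Dm]
  have hpow1 : (k : ℚ) ^ ν = k ^ (ν - 2) * k ^ 2 := by rw [← pow_add]; congr 1; omega
  have hpow2 : (k : ℚ) ^ (ν - 1) = k ^ (ν - 2) * k := by rw [← pow_succ]; congr 1; omega
  have hinv : Dm * (of fun _ _ => ((k : ℚ) ^ ν)⁻¹) = 1 := by
    ext
    simp [Dm, mul_apply, hk0]
  let _ : Invertible Dm := invertibleOfRightInverse _ _ hinv
  have hinvOf : ⅟Dm = of fun _ _ => ((k : ℚ) ^ ν)⁻¹ := rfl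
  let Y : Matrix (Fin (k - 1) × Fin ν) (Fin (k - 1) × Fin ν) ℚ := of fun a b =>
    if a.2 = b.2 then (if a.1 = b.1 then (k : ℚ) ^ (ν - 1) else 0) else k ^ (ν - 2)
  have hblock : ((A * Aᵀ).map (Int.castRingHom ℚ)).submatrix e e = fromBlocks Y B Bᵀ Dm := by
    ext a b
    rcases a with a | a <;> rcases b with b | b
    · simp [e, hss, Y]
    · simp [e, hsn, B]
    · simp [e, hns, B]
    · simp [e, hnn, Dm]
  -- Eliminating the total sum subtracts `k^(ν-2)` from every entry. This is exactly the entry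
  -- between two different directions, so only the blocks `k^(ν-1) (1 - J/k)` remain, with `J` the
  -- all-ones matrix; their determinants follow from a rank-one update.
  have hschur : Y - B * ⅟Dm * Bᵀ = blockDiagonal fun _ : Fin ν => X := by
    ext ⟨j, i⟩ ⟨j', i'⟩
    rw [hinvOf, blockDiagonal_apply]
    simp only [Y, B, X, Matrix.sub_apply, of_apply, mul_apply, transpose_apply, Matrix.smul_apply, Matrix.add_apply,
      one_apply, replicateCol_apply, replicateRow_apply, Finset.univ_unique, Finset.sum_singleton,
      smul_eq_mul]
    rw [hpow1, hpow2]
    split_ifs <;> field_simp <;> ring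
  have hX : X.det = (k : ℚ) ^ ((ν - 1) * (k - 1)) / k := by
    rw [det_smul, det_one_add_replicateCol_mul_replicateRow, Fintype.card_fin, ← pow_mul]
    simp [dotProduct, Nat.cast_sub hk.le]
    field_simp
    ring
  rw [hblock, det_fromBlocks₂₂, hschur, det_blockDiagonal, hDdet, Finset.prod_const, hX,
    Finset.card_univ, Fintype.card_fin, div_pow, mul_div_cancel₀ _ (by positivity), ← pow_mul]
  congr 1
  obtain ⟨m, hm⟩ : ∃ m, ν = m + 1 := ⟨ν - 1, by omega⟩
  have : (m + 1) ^ 2 - (m + 1) = m * (m + 1) := by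
    rw [Nat.sub_eq_iff_eq_add (by nlinarith)]; ring
  rw [hm, this, Nat.add_sub_cancel]
  ring

end Determinant

/-! ### Counting tables -/

section Counting

variable {ν : ℕ} {k : Fin ν → ℕ} {β : (i : Fin ν) → Fin (k i) → ℕ} {N : ℕ}

/-- The tables with nonnegative integer entries that satisfy the equations. -/
def natTables (k : Fin ν → ℕ) (β : (i : Fin ν) → Fin (k i) → ℕ) (N : ℕ) : Set (Cell k → ℕ) :=
  {x | (tableMatrix k *ᵥ fun p => (x p : ℤ)) = tableRhs k β N}

lemma mem_transportPolytope_iff {x : Cell k → ℝ} :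
    x ∈ transportPolytope k β N ↔
      (∀ c, ∑ p, (tableMatrix k c p : ℝ) * x p = tableRhs k β N c) ∧ ∀ p, 0 ≤ x p := by
  rw [transportPolytope, polytope, Set.mem_ofPred_eq, funext_iff]
  rfl

lemma sum_eq_of_mem_transportPolytope {x : Cell k → ℝ} (hx : x ∈ transportPolytope k β N) :
    ∑ p, x p = N := by
  have := (mem_transportPolytope_iff.mp hx).1 none
  simpa [tableMatrix, tableRhs] using this

lemma natCast_mem_transportPolytope_iff {x : Cell k → ℕ} :
    (fun p => (x p : ℝ)) ∈ transportPolytope k β N ↔ x ∈ natTables k β N := by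
  rw [mem_transportPolytope_iff, natTables, Set.mem_ofPred_eq, funext_iff,
    and_iff_left fun p => Nat.cast_nonneg _]
  refine forall_congr' fun c => ?_
  rw [mulVec, dotProduct]
  exact_mod_cast Iff.rfl

lemma finite_natTables : (natTables k β N).Finite := by
  refine (Set.finite_Iic (fun _ : Cell k => N)).subset fun x hx p => ?_
  have h := sum_eq_of_mem_transportPolytope (natCast_mem_transportPolytope_iff.mpr hx)
  have h2 : ∑ p, x p = N := by exact_mod_cast h
  rw [← h2]
  exact Finset.single_le_sum (fun _ _ => Nat.zero_le _) (Finset.mem_univ p)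

lemma natCast_comp_injective : Function.Injective fun (x : Cell k → ℕ) p => (x p : ℝ) :=
  fun _ _ h => funext fun p => Nat.cast_injective (congrFun h p)

lemma numIntegerPoints_transportPolytope :
    numIntegerPoints (transportPolytope k β N) = (natTables k β N).ncard := by
  rw [numIntegerPoints, ← Set.ncard_image_of_injective _ natCast_comp_injective]
  congr 1
  ext x
  constructor
  · rintro ⟨hx, hm⟩
    choose m hm using hm
    have hm0 : ∀ p, 0 ≤ m p := fun p => by
      have := (mem_transportPolytope_iff.mp hx).2 p
      rw [hm p] at this
      exact_mod_cast this
    have hxe : (fun p => ((m p).toNat : ℝ)) = x := by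
      funext p
      rw [hm p]
      exact_mod_cast Int.toNat_of_nonneg (hm0 p)
    refine ⟨fun p => (m p).toNat, ?_, hxe⟩
    rw [← natCast_mem_transportPolytope_iff, hxe]
    exact hx
  · rintro ⟨y, hy, rfl⟩
    exact ⟨natCast_mem_transportPolytope_iff.mpr hy, fun p => ⟨y p, by simp⟩⟩

lemma numBinaryPoints_transportPolytope01 :
    numBinaryPoints (transportPolytope01 k β N) =
      {x | x ∈ natTables k β N ∧ ∀ p, x p = 0 ∨ x p = 1}.ncard := by
  rw [numBinaryPoints, ← Set.ncard_image_of_injective _ natCast_comp_injective]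
  congr 1
  ext x
  constructor
  · rintro ⟨hx, hm⟩
    have hxe : (fun p => ((if x p = 0 then 0 else 1 : ℕ) : ℝ)) = x := by
      funext p
      rcases hm p with h | h <;> simp [h]
    refine ⟨fun p => if x p = 0 then 0 else 1, ⟨?_, fun p => ?_⟩, hxe⟩
    · rw [← natCast_mem_transportPolytope_iff, hxe]
      exact hx.1
    · dsimp only
      split_ifs <;> simp
  · rintro ⟨y, ⟨hy, hy01⟩, rfl⟩
    refine ⟨⟨natCast_mem_transportPolytope_iff.mpr hy, fun p => ?_⟩, fun p => ?_⟩
    · rcases hy01 p with h | h <;> simp [h]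
    · rcases hy01 p with h | h <;> simp [h]

/-- Equal atoms turn a probability into a count. For integer tables `S' = S`; for binary tables `S`
also contains tables with larger entries, which have probability `0`. -/
lemma measureReal_pi_eq_ncard_mul {J : Type} [Fintype J] (μ : J → Measure ℕ)
    [∀ j, IsProbabilityMeasure (μ j)] {S S' : Set (J → ℕ)} (hS : S.Finite) (hSS : S' ⊆ S) {e : ℝ}
    (h1 : ∀ x ∈ S', ∏ j, (μ j).real {x j} = e)
    (h0 : ∀ x ∈ S, x ∉ S' → ∏ j, (μ j).real {x j} = 0) :
    (Measure.pi μ).real S = S'.ncard * e := by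
  classical
  have hsing : ∀ x : J → ℕ, (Measure.pi μ).real {x} = ∏ j, (μ j).real {x j} := fun x => by
    rw [measureReal_def, Measure.pi_singleton, ENNReal.toReal_prod]
    rfl
  have hS' := hS.subset hSS
  rw [Set.ncard_eq_toFinset_card _ hS', ← nsmul_eq_mul, ← Finset.sum_const]
  conv_lhs => rw [← hS.coe_toFinset]
  rw [← sum_measureReal_singleton]
  have hsub : hS'.toFinset ⊆ hS.toFinset := Set.Finite.toFinset_subset_toFinset.mpr hSS
  refine (Finset.sum_subset hsub fun x hx hx' => ?_).symm.trans ?_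
  · rw [hsing, h0 x (hS.mem_toFinset.mp hx) fun h => hx' (hS'.mem_toFinset.mpr h)]
  · exact Finset.sum_congr rfl fun x hx => by rw [hsing, h1 x (hS'.mem_toFinset.mp hx)]

/-! ### Critical points of the entropy -/

lemma sum_mul_deriv_eq_zero {J : Type} [Fintype J] {φ : ℝ → ℝ} {z v φ' : J → ℝ}
    (hφ : ∀ j, HasDerivAt φ (φ' j) (z j))
    (hmax : IsLocalMax (fun τ : ℝ => ∑ j, φ (z j + τ * v j)) 0) : ∑ j, v j * φ' j = 0 := by
  refine hmax.hasDerivAt_eq_zero (HasDerivAt.fun_sum fun j _ => ?_)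
  have h1 : HasDerivAt (fun τ : ℝ => z j + τ * v j) (v j) 0 := by
    simpa using ((hasDerivAt_id (0 : ℝ)).mul_const (v j)).const_add (z j)
  have h2 : HasDerivAt φ (φ' j) (z j + 0 * v j) := by simpa using hφ j
  exact (h2.comp (0 : ℝ) h1).congr_deriv (mul_comm _ _)

/-- Strict positivity of `z` leaves room on both sides, so the derivative of the entropy along `x -
z` vanishes at a maximum and is not merely nonpositive. -/
lemma eventually_mem_transportPolytope {x z : Cell k → ℝ} (hx : x ∈ transportPolytope k β N)
    (hz : z ∈ transportPolytope k β N) (hz0 : ∀ p, 0 < z p) :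
    ∀ᶠ τ : ℝ in nhds 0, (fun p => z p + τ * (x p - z p)) ∈ transportPolytope k β N := by
  have h : ∀ᶠ τ : ℝ in nhds 0, ∀ p, 0 < z p + τ * (x p - z p) := by
    refine Filter.eventually_all.mpr fun p => ?_
    have hc : Continuous fun τ : ℝ => z p + τ * (x p - z p) := by fun_prop
    exact hc.continuousAt.eventually (lt_mem_nhds (by simpa using hz0 p))
  filter_upwards [h] with τ hτ
  rw [mem_transportPolytope_iff] at hx hz ⊢
  refine ⟨fun c => ?_, fun p => (hτ p).le⟩
  have e : ∀ p, (tableMatrix k c p : ℝ) * (z p + τ * (x p - z p)) =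
      (1 - τ) * ((tableMatrix k c p : ℝ) * z p) + τ * ((tableMatrix k c p : ℝ) * x p) :=
    fun p => by ring
  simp_rw [e]
  rw [Finset.sum_add_distrib, ← Finset.mul_sum, ← Finset.mul_sum, hx.1 c, hz.1 c]
  ring

lemma critical_of_isMaxOn_geomEntropy {z : Cell k → ℝ} (hz : z ∈ transportPolytope k β N)
    (hz0 : ∀ p, 0 < z p) (hmax : IsMaxOn geomEntropy (transportPolytope k β N) z)
    {x : Cell k → ℝ} (hx : x ∈ transportPolytope k β N) :
    ∑ p, (x p - z p) * Real.log ((1 + z p) / z p) = 0 := by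
  refine sum_mul_deriv_eq_zero (z := z) (v := fun p => x p - z p)
    (φ := fun y => (y + 1) * Real.log (y + 1) - y * Real.log y) (fun p => ?_) ?_
  · have hp := hz0 p
    have h1 := (Real.hasDerivAt_mul_log (by positivity : z p + 1 ≠ 0)).comp_add_const (z p) 1
    have h2 := Real.hasDerivAt_mul_log hp.ne'
    refine (h1.sub h2).congr_deriv ?_
    rw [Real.log_div (by positivity) hp.ne', add_comm 1]
    ring
  · filter_upwards [eventually_mem_transportPolytope hx hz hz0] with τ hτ
    have := hmax hτ
    simpa [geomEntropy] using this

lemma critical_of_isMaxOn_bernoulliEntropy {z : Cell k → ℝ}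
    (hz : z ∈ transportPolytope01 k β N) (hz0 : ∀ p, 0 < z p) (hz1 : ∀ p, z p < 1)
    (hmax : IsMaxOn bernoulliEntropy (transportPolytope01 k β N) z)
    {x : Cell k → ℝ} (hx : x ∈ transportPolytope01 k β N) :
    ∑ p, (x p - z p) * Real.log ((1 - z p) / z p) = 0 := by
  refine sum_mul_deriv_eq_zero (z := z) (v := fun p => x p - z p)
    (φ := fun y => y * Real.log (1 / y) + (1 - y) * Real.log (1 / (1 - y))) (fun p => ?_) ?_
  · have hp := hz0 p
    have hp1 : 0 < 1 - z p := by linarith [hz1 p]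
    have h1 := (Real.hasDerivAt_mul_log hp1.ne').comp_const_sub 1 (z p)
    have h2 := Real.hasDerivAt_mul_log hp.ne'
    have h3 : (fun y : ℝ => y * Real.log (1 / y) + (1 - y) * Real.log (1 / (1 - y))) =
        fun y => -(y * Real.log y) - (1 - y) * Real.log (1 - y) := by
      funext y
      rw [one_div, one_div, Real.log_inv, Real.log_inv]
      ring
    rw [h3]
    refine (h2.neg.sub h1).congr_deriv ?_
    rw [Real.log_div hp1.ne' hp.ne']
    ring
  · have h : ∀ᶠ τ : ℝ in nhds 0, ∀ p, z p + τ * (x p - z p) < 1 := by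
      refine Filter.eventually_all.mpr fun p => ?_
      have hc : Continuous fun τ : ℝ => z p + τ * (x p - z p) := by fun_prop
      exact hc.continuousAt.eventually (gt_mem_nhds (by simpa using hz1 p))
    filter_upwards [eventually_mem_transportPolytope hx.1 hz.1 hz0, h] with τ hτ hτ1
    have := hmax (show (fun p => z p + τ * (x p - z p)) ∈ transportPolytope01 k β N from
      ⟨hτ, fun p => (hτ1 p).le⟩)
    simpa [bernoulliEntropy] using this

/-! ### Probabilities of single tables -/

lemma prod_geomDist_singleton {z : Cell k → ℝ} (hz0 : ∀ p, 0 < z p) {x : Cell k → ℕ}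
    (hcrit : ∑ p, ((x p : ℝ) - z p) * Real.log ((1 + z p) / z p) = 0) :
    ∏ p, (geomDist (z p)).real {x p} = Real.exp (-geomEntropy z) := by
  simp_rw [fun p => geomDist_real_singleton (hz0 p) (x p)]
  rw [← Real.exp_sum, Finset.sum_sub_distrib, hcrit, Finset.sum_neg_distrib, sub_zero, geomEntropy]

lemma bernDist_real_singleton {y : ℝ} (h0 : 0 < y) (h1 : y < 1) {n : ℕ} (hn : n = 0 ∨ n = 1) :
    (bernDist y).real {n} =
      Real.exp (-(y * Real.log (1 / y) + (1 - y) * Real.log (1 / (1 - y)))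
        - (n - y) * Real.log ((1 - y) / y)) := by
  have h1' : 0 < 1 - y := by linarith
  rw [Real.log_div h1'.ne' h0.ne', one_div, one_div, Real.log_inv, Real.log_inv]
  rcases hn with rfl | rfl
  · rw [bernDist_real_zero h0.le h1.le, Nat.cast_zero]
    ring_nf
    rw [Real.exp_log h1']
  · rw [bernDist_real_one h0.le h1.le, Nat.cast_one]
    ring_nf
    rw [Real.exp_log h0]

lemma prod_bernDist_singleton {z : Cell k → ℝ} (hz0 : ∀ p, 0 < z p) (hz1 : ∀ p, z p < 1)
    {x : Cell k → ℕ} (hx : ∀ p, x p = 0 ∨ x p = 1)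
    (hcrit : ∑ p, ((x p : ℝ) - z p) * Real.log ((1 - z p) / z p) = 0) :
    ∏ p, (bernDist (z p)).real {x p} = Real.exp (-bernoulliEntropy z) := by
  simp_rw [fun p => bernDist_real_singleton (hz0 p) (hz1 p) (hx p)]
  rw [← Real.exp_sum, Finset.sum_sub_distrib, hcrit, Finset.sum_neg_distrib, sub_zero,
    bernoulliEntropy]

/-! ### The Gaussian formulas at critical points -/

lemma rpow_half_eq_sqrt_pow {a : ℝ} (ha : 0 ≤ a) (d : ℕ) :
    a ^ ((d : ℝ) / 2) = Real.sqrt a ^ d := by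
  rw [Real.sqrt_eq_rpow, ← Real.rpow_natCast, ← Real.rpow_mul ha]
  congr 1
  ring

/-- When `n` counts tables of probability `exp (-S)` each, the right-hand side is the quantity that
the local limit theorem compares with `1`. -/
lemma div_gaussianFormula_tableMatrix (hk : ∀ i, 1 < k i) (n S : ℝ) (w : Cell k → ℝ) :
    n / gaussianFormula (tableMatrix k) S w =
      n * Real.exp (-S) * (Real.sqrt (2 * Real.pi) ^ Fintype.card (Constraint k) * Real.sqrt
        (weightedMatrix (tableMatrix k) w * (weightedMatrix (tableMatrix k) w)ᵀ).det) := by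
  rw [gaussianFormula, covolume_imageLattice_tableMatrix hk,
    rpow_half_eq_sqrt_pow (by have := Real.pi_pos; positivity), Real.exp_neg, mul_one, div_div_eq_mul_div,
    div_eq_mul_inv]
  ring

/-- The Gaussian formula for integer tables at a critical point of the entropy. -/
theorem integer_tables_of_critical (hν : 5 ≤ ν) {c δ ε : ℝ} (C M : ℝ) (hc : 0 < c) (hδ : 0 < δ)
    (hε : 0 < ε) :
    ∃ n₀ : ℕ, ∀ n : ℕ, n₀ ≤ n → ∀ k : Fin ν → ℕ, (∀ i, 1 < k i) →
      (∀ i, c * n ≤ k i ∧ (k i : ℝ) ≤ C * n) →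
      ∀ (β : (i : Fin ν) → Fin (k i) → ℕ) (N : ℕ), ∀ z ∈ transportPolytope k β N,
      (∀ x ∈ transportPolytope k β N, ∑ p, (x p - z p) * Real.log ((1 + z p) / z p) = 0) →
      (∀ p, δ ≤ z p ∧ z p ≤ M) →
      |(numIntegerPoints (transportPolytope k β N) : ℝ)
        / gaussianInteger (tableMatrix k) z - 1| ≤ ε := by
  obtain ⟨κ, L, hκ, hL, hnear⟩ := exists_isNearGaussian_geomDist M hδ
  obtain ⟨n₀, hn₀⟩ := table_local_limit hν C (M ^ 2 + M) hc
    (by positivity : 0 < δ ^ 2 + δ) hκ hL hε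
  refine ⟨n₀, fun n hn k hk hkn β N z hz hcrit hzb => ?_⟩
  have hz0 : ∀ p, 0 < z p := fun p => hδ.trans_le (hzb p).1
  have h := hn₀ n hn k hk hkn (fun p => geomDist (z p)) (fun p => inferInstance) z
    (fun p => z p ^ 2 + z p)
    (fun p => by
      obtain ⟨h1, h2⟩ := hzb p
      have := hz0 p
      constructor <;> gcongr)
    (fun p => hnear (z p) (hzb p).1 (hzb p).2) (tableRhs k β N)
    (mem_transportPolytope_iff.mp hz).1
  rw [gaussianInteger, div_gaussianFormula_tableMatrix hk, numIntegerPoints_transportPolytope,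
    ← measureReal_pi_eq_ncard_mul (fun p => geomDist (z p)) finite_natTables subset_rfl
      (fun x hx => prod_geomDist_singleton hz0
        (hcrit _ (natCast_mem_transportPolytope_iff.mpr hx)))
      (fun x hx hx' => absurd hx hx')]
  exact h

/-- The Gaussian formula for binary tables at a critical point of the entropy. -/
theorem binary_tables_of_critical (hν : 5 ≤ ν) {c δ ε : ℝ} (C : ℝ) (hc : 0 < c) (hδ : 0 < δ)
    (hε : 0 < ε) :
    ∃ n₀ : ℕ, ∀ n : ℕ, n₀ ≤ n → ∀ k : Fin ν → ℕ, (∀ i, 1 < k i) →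
      (∀ i, c * n ≤ k i ∧ (k i : ℝ) ≤ C * n) →
      ∀ (β : (i : Fin ν) → Fin (k i) → ℕ) (N : ℕ), ∀ z ∈ transportPolytope01 k β N,
      (∀ x ∈ transportPolytope01 k β N, ∑ p, (x p - z p) * Real.log ((1 - z p) / z p) = 0) →
      (∀ p, δ ≤ z p ∧ z p ≤ 1 - δ) →
      |(numBinaryPoints (transportPolytope01 k β N) : ℝ)
        / gaussianBinary (tableMatrix k) z - 1| ≤ ε := by
  obtain ⟨κ, L, hκ, hL, hnear⟩ := exists_isNearGaussian_bernDist hδ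
  obtain ⟨n₀, hn₀⟩ := table_local_limit hν C 1 hc (by positivity : 0 < δ ^ 2) hκ hL hε
  refine ⟨n₀, fun n hn k hk hkn β N z hz hcrit hzb => ?_⟩
  have hz0 : ∀ p, 0 < z p := fun p => hδ.trans_le (hzb p).1
  have hz1 : ∀ p, z p < 1 := fun p => by linarith [(hzb p).2]
  have h := hn₀ n hn k hk hkn (fun p => bernDist (z p)) (fun p => inferInstance) z
    (fun p => z p - z p ^ 2)
    (fun p => by
      obtain ⟨h1, h2⟩ := hzb p
      have := hz0 p
      constructor <;> nlinarith)
    (fun p => hnear (z p) (hzb p).1 (hzb p).2) (tableRhs k β N)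
    (mem_transportPolytope_iff.mp hz.1).1
  have hmem : ∀ x : Cell k → ℕ, x ∈ natTables k β N → (∀ p, x p = 0 ∨ x p = 1) →
      (fun p => (x p : ℝ)) ∈ transportPolytope01 k β N := fun x hx hx01 =>
    ⟨natCast_mem_transportPolytope_iff.mpr hx, fun p => by rcases hx01 p with h | h <;> simp [h]⟩
  rw [gaussianBinary, div_gaussianFormula_tableMatrix hk, numBinaryPoints_transportPolytope01,
    ← measureReal_pi_eq_ncard_mul (fun p => bernDist (z p)) finite_natTables (fun x hx => hx.1)
      (fun x hx => prod_bernDist_singleton hz0 hz1 hx.2 (hcrit _ (hmem x hx.1 hx.2)))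
      (fun x hx hx' => ?_)]
  · exact h
  · obtain ⟨p, hp⟩ : ∃ p, ¬(x p = 0 ∨ x p = 1) := by
      by_contra! hall
      exact hx' ⟨hx, fun p => hall p⟩
    exact Finset.prod_eq_zero (Finset.mem_univ p) (bernDist_real_of_two_le _ (by omega))

end Counting

/-! ### Tables with equal sides and equal sectional sums -/

section Cubic

variable {ν k : ℕ}

lemma weightedMatrix_const_mul_transpose {D J : Type} [Fintype D] [DecidableEq D] [Fintype J]
    (A : Matrix D J ℤ) {w : ℝ} (hw : 0 ≤ w) :
    weightedMatrix A (fun _ => w) * (weightedMatrix A fun _ => w)ᵀ =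
      w • (A * Aᵀ).map (Int.cast : ℤ → ℝ) := by
  ext c c'
  simp only [mul_apply, transpose_apply, weightedMatrix, of_apply, Matrix.smul_apply, map_apply,
    smul_eq_mul, Int.cast_sum, Int.cast_mul, Finset.mul_sum]
  refine Finset.sum_congr rfl fun p _ => ?_
  rw [mul_mul_mul_comm, Real.mul_self_sqrt hw]

lemma gaussianFormula_cubic (hν : 2 ≤ ν) (hk : 1 < k) (S : ℝ) {w : ℝ} (hw : 0 < w) :
    gaussianFormula (tableMatrix (fun _ : Fin ν => k)) S (fun _ => w) =
      Real.exp S * (2 * Real.pi * w) ^ (-((k : ℝ) * ν - ν + 1) / 2) *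
        (k : ℝ) ^ (((ν : ℝ) - (ν : ℝ) ^ 2) * ((k : ℝ) - 1) / 2) := by
  have hpi := Real.pi_pos
  have hk0 : (0 : ℝ) < k := by positivity
  have hd : (Fintype.card (Constraint fun _ : Fin ν => k) : ℝ) = k * ν - ν + 1 := by
    rw [card_constraint_cast fun _ => hk]
    simp
    ring
  have hexp : (((ν ^ 2 - ν) * (k - 1) : ℕ) : ℝ) = ((ν : ℝ) ^ 2 - ν) * (k - 1) := by
    rw [Nat.cast_mul, Nat.cast_sub (by nlinarith), Nat.cast_sub hk.le]
    push_cast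
    ring
  have hdet : (weightedMatrix (tableMatrix (fun _ : Fin ν => k)) (fun _ => w) *
      (weightedMatrix (tableMatrix (fun _ : Fin ν => k)) fun _ => w)ᵀ).det =
      w ^ ((k : ℝ) * ν - ν + 1) * (k : ℝ) ^ (((ν : ℝ) ^ 2 - ν) * (k - 1)) := by
    rw [weightedMatrix_const_mul_transpose _ hw.le, det_smul, ← Int.cast_det,
      det_tableMatrix_mul_transpose hν hk, ← hd, ← hexp, Real.rpow_natCast, Real.rpow_natCast]
    push_cast
    rfl
  have h2pi : 0 < 2 * Real.pi := by positivity
  rw [gaussianFormula, covolume_imageLattice_tableMatrix fun _ => hk, hdet, hd, mul_one,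
    Real.mul_rpow h2pi.le hw.le, Real.sqrt_eq_rpow,
    Real.mul_rpow (Real.rpow_nonneg hw.le _) (Real.rpow_nonneg hk0.le _), ← Real.rpow_mul hw.le,
    ← Real.rpow_mul hk0.le, div_eq_mul_inv, mul_inv, mul_inv,
    ← Real.rpow_neg h2pi.le, ← Real.rpow_neg hw.le, ← Real.rpow_neg hk0.le]
  ring_nf

lemma const_mem_transportPolytope (hν : 1 ≤ ν) {α : ℝ} {r : ℕ} (hα : 0 ≤ α)
    (hr : (r : ℝ) = α * (k : ℝ) ^ (ν - 1)) :
    (fun _ => α) ∈ transportPolytope (fun _ : Fin ν => k) (fun _ _ => r) (k * r) := by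
  refine mem_transportPolytope_iff.mpr ⟨fun c => ?_, fun _ => hα⟩
  rw [← Finset.sum_mul]
  rcases c with _ | ⟨i, j⟩
  · have hpow : (k : ℝ) ^ ν = k * k ^ (ν - 1) := by
      rw [← pow_succ']
      congr 1
      omega
    simp [tableMatrix, tableRhs, hr, hpow]
    ring
  · have h := sum_section_indicator (ν := ν) i j
    have h2 : ∑ p : Cell (fun _ : Fin ν => k),
        (tableMatrix (fun _ : Fin ν => k) (some ⟨i, j⟩) p : ℝ) = (k : ℝ) ^ (ν - 1) := by
      have e : ∀ p, tableMatrix (fun _ : Fin ν => k) (some ⟨i, j⟩) p =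
          if (p i : ℕ) = j then (1 : ℤ) else 0 := fun _ => rfl
      simp_rw [e]
      rw [← Int.cast_sum, h]
      push_cast
      rfl
    rw [h2]
    simp [tableRhs, hr]
    ring

/-- For a constant table the logarithmic factor is the same in all cells, so criticality follows
from the prescribed total sum alone, and maximality need not be proved. -/
lemma critical_const {x : Cell (fun _ : Fin ν => k) → ℝ} {r : ℕ} {α : ℝ}
    (hx : x ∈ transportPolytope (fun _ : Fin ν => k) (fun _ _ => r) (k * r))
    (hα : (fun _ => α) ∈ transportPolytope (fun _ : Fin ν => k) (fun _ _ => r) (k * r)) (l : ℝ) :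
    ∑ p, (x p - α) * l = 0 := by
  have h1 := sum_eq_of_mem_transportPolytope hx
  have h2 := sum_eq_of_mem_transportPolytope hα
  rw [← Finset.sum_mul, Finset.sum_sub_distrib, h1, h2, sub_self, zero_mul]

lemma exp_geomEntropy_const {α : ℝ} (hα : 0 < α) :
    Real.exp (geomEntropy fun _ : Cell (fun _ : Fin ν => k) => α) =
      ((α + 1) ^ (α + 1) * α ^ (-α)) ^ (k ^ ν) := by
  rw [Real.rpow_def_of_pos hα, Real.rpow_def_of_pos (by positivity), ← Real.exp_add,
    ← Real.exp_nat_mul, geomEntropy, Finset.sum_const, Finset.card_univ, nsmul_eq_mul,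
    card_cell_cast]
  congr 1
  simp
  left
  ring

lemma exp_bernoulliEntropy_const {α : ℝ} (hα : 0 < α) (hα1 : α < 1) :
    Real.exp (bernoulliEntropy fun _ : Cell (fun _ : Fin ν => k) => α) =
      (α ^ α * (1 - α) ^ (1 - α)) ^ (-((k : ℝ) ^ ν)) := by
  have h1 : 0 < 1 - α := by linarith
  rw [Real.rpow_def_of_pos hα, Real.rpow_def_of_pos h1, ← Real.exp_add,
    Real.rpow_def_of_pos (Real.exp_pos _), Real.log_exp, bernoulliEntropy, Finset.sum_const,
    Finset.card_univ, nsmul_eq_mul, card_cell_cast]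
  congr 1
  simp
  ring

end Cubic

/-! ### The main theorem -/

theorem mainTheorem9 (ν : ℕ) (hν : 2 ≤ ν) :
    -- the determinant of `A Aᵀ` for `k × … × k` tables
    (∀ k : ℕ, 1 < k →
      (tableMatrix (fun _ : Fin ν => k) * (tableMatrix (fun _ : Fin ν => k))ᵀ).det
        = (k : ℤ) ^ ((ν ^ 2 - ν) * (k - 1))) ∧
    (5 ≤ ν →
      -- nonnegative integer tables
      (∀ c C δ M ε : ℝ, 0 < c → 0 < δ → 0 < ε → ∃ n₀ : ℕ, ∀ n : ℕ, n₀ ≤ n →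
        ∀ k : Fin ν → ℕ, (∀ i, 1 < k i) → (∀ i, c * n ≤ k i ∧ (k i : ℝ) ≤ C * n) →
        ∀ (β : (i : Fin ν) → Fin (k i) → ℕ) (N : ℕ),
          (∀ i j, 0 < β i j) → (∀ i, ∑ j, β i j = N) →
        ∀ z ∈ transportPolytope k β N,
          IsMaxOn geomEntropy (transportPolytope k β N) z →
          (∀ p, δ ≤ z p ∧ z p ≤ M) →
          |(numIntegerPoints (transportPolytope k β N) : ℝ)
              / gaussianInteger (tableMatrix k) z - 1| ≤ ε) ∧
      -- binary tables
      (∀ c C δ ε : ℝ, 0 < c → 0 < δ → δ < 1 / 2 → 0 < ε → ∃ n₀ : ℕ, ∀ n : ℕ, n₀ ≤ n →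
        ∀ k : Fin ν → ℕ, (∀ i, 1 < k i) → (∀ i, c * n ≤ k i ∧ (k i : ℝ) ≤ C * n) →
        ∀ (β : (i : Fin ν) → Fin (k i) → ℕ) (N : ℕ),
          (∀ i j, 0 < β i j) → (∀ i, ∑ j, β i j = N) →
        ∀ z ∈ transportPolytope01 k β N,
          IsMaxOn bernoulliEntropy (transportPolytope01 k β N) z →
          (∀ p, δ ≤ z p ∧ z p ≤ 1 - δ) →
          |(numBinaryPoints (transportPolytope01 k β N) : ℝ)
              / gaussianBinary (tableMatrix k) z - 1| ≤ ε) ∧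
      -- `k × … × k` nonnegative integer tables with all sectional sums `r = α k ^ (ν - 1)`
      (∀ a b ε : ℝ, 0 < a → 0 < ε → ∃ k₀ : ℕ, ∀ k : ℕ, k₀ ≤ k →
        ∀ (α : ℝ) (r : ℕ), a ≤ α → α ≤ b → (r : ℝ) = α * (k : ℝ) ^ (ν - 1) →
          |(numIntegerPoints
                (transportPolytope (fun _ : Fin ν => k) (fun _ _ => r) (k * r)) : ℝ)
              / (((α + 1) ^ (α + 1) * α ^ (-α)) ^ (k ^ ν)
                * (2 * Real.pi * α ^ 2 + 2 * Real.pi * α) ^ (-((k : ℝ) * ν - ν + 1) / 2)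
                * (k : ℝ) ^ (((ν : ℝ) - (ν : ℝ) ^ 2) * ((k : ℝ) - 1) / 2)) - 1| ≤ ε) ∧
      -- `k × … × k` binary tables with all sectional sums `r = α k ^ (ν - 1)`
      (∀ a b ε : ℝ, 0 < a → b < 1 → 0 < ε → ∃ k₀ : ℕ, ∀ k : ℕ, k₀ ≤ k →
        ∀ (α : ℝ) (r : ℕ), a ≤ α → α ≤ b → (r : ℝ) = α * (k : ℝ) ^ (ν - 1) →
          |(numBinaryPoints
                (transportPolytope01 (fun _ : Fin ν => k) (fun _ _ => r) (k * r)) : ℝ)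
              / ((α ^ α * (1 - α) ^ (1 - α)) ^ (-((k : ℝ) ^ ν))
                * (2 * Real.pi * α - 2 * Real.pi * α ^ 2) ^ (-((k : ℝ) * ν - ν + 1) / 2)
                * (k : ℝ) ^ (((ν : ℝ) - (ν : ℝ) ^ 2) * ((k : ℝ) - 1) / 2)) - 1| ≤ ε)) := by
  refine ⟨fun k hk => det_tableMatrix_mul_transpose hν hk, fun hν5 => ⟨?_, ?_, ?_, ?_⟩⟩
  · intro c C δ M ε hc hδ hε
    obtain ⟨n₀, hn₀⟩ := integer_tables_of_critical hν5 C M hc hδ hε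
    exact ⟨n₀, fun n hn k hk hkn β N _ _ z hz hmax hzb => hn₀ n hn k hk hkn β N z hz
      (fun x hx => critical_of_isMaxOn_geomEntropy hz (fun p => hδ.trans_le (hzb p).1) hmax hx)
      hzb⟩
  · intro c C δ ε hc hδ _ hε
    obtain ⟨n₀, hn₀⟩ := binary_tables_of_critical hν5 C hc hδ hε
    exact ⟨n₀, fun n hn k hk hkn β N _ _ z hz hmax hzb => hn₀ n hn k hk hkn β N z hz
      (fun x hx => critical_of_isMaxOn_bernoulliEntropy hz (fun p => hδ.trans_le (hzb p).1)
        (fun p => by linarith [(hzb p).2]) hmax hx) hzb⟩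
  · intro a b ε ha hε
    -- Taking `n = k` gives `c = C = 1`, and the constant table `α` lies between `δ = a` and `M =
    -- b`.
    obtain ⟨n₀, hn₀⟩ := integer_tables_of_critical hν5 1 b one_pos ha hε
    refine ⟨max n₀ 2, fun k hk α r haα hαb hr => ?_⟩
    have hα : 0 < α := ha.trans_le haα
    have hk1 : 1 < k := (le_max_right _ _).trans hk
    have hz := const_mem_transportPolytope (by omega) hα.le hr
    have h := hn₀ k ((le_max_left _ _).trans hk) (fun _ => k) (fun _ => hk1)
      (fun _ => by simp) (fun _ _ => r) (k * r) (fun _ => α) hz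
      (fun x hx => critical_const hx hz _) (fun _ => ⟨haα, hαb⟩)
    rw [gaussianInteger, gaussianFormula_cubic hν hk1 _ (by positivity),
      exp_geomEntropy_const hα, mul_add] at h
    exact h
  · intro a b ε ha hb hε
    -- `δ = min a (1 - b)` keeps `α` away from both `0` and `1`.
    obtain ⟨n₀, hn₀⟩ := binary_tables_of_critical hν5 1 one_pos
      (lt_min ha (sub_pos.mpr hb) : 0 < min a (1 - b)) hε
    refine ⟨max n₀ 2, fun k hk α r haα hαb hr => ?_⟩
    have hα : 0 < α := ha.trans_le haα
    have hα1 : α < 1 := hαb.trans_lt hb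
    have hk1 : 1 < k := (le_max_right _ _).trans hk
    have hz := const_mem_transportPolytope (by omega) hα.le hr
    have h := hn₀ k ((le_max_left _ _).trans hk) (fun _ => k) (fun _ => hk1)
      (fun _ => by simp) (fun _ _ => r) (k * r) (fun _ => α) ⟨hz, fun _ => hα1.le⟩
      (fun x hx => critical_const hx.1 hz _)
      (fun _ => ⟨(min_le_left _ _).trans haα, by linarith [min_le_right a (1 - b)]⟩)
    rw [gaussianBinary, gaussianFormula_cubic hν hk1 _ (by nlinarith),
      exp_bernoulliEntropy_const hα hα1, mul_sub] at h
    exact h
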